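/- **Setting.** Let $G=(V,E)$ be a decomposable undirected graph with $p=|V|$ nodes (that is, $G$ is complete, or $V=A\cup B$ with $A\cap B$ complete and separating $A$ from $B$ and with $G[A],G[B]$ decomposable). Let $\mathcal Q$ be the set of its cliques (maximal complete node sets). Let $T$ be a junction tree of $G$, i.e. a tree with node set $\mathcal Q$ such that $Q\cap Q'$ is contained in every clique on the path between $Q$ and $Q'$ (one exists, since $G$ is decomposable). Let $\mathcal S$ be the multiset of separators, the intersections $Q\cap Q'$ over the edges $QQ'$ of $T$. For $A\subseteq V$, the subscript $A$ denotes the restriction of a vector to $A$ or the principal submatrix of a matrix on $A$. Empty blocks have determinant $1$. Let $M_G$ be the set of symmetric positive definite $\Sigma\in\mathbb R^{V\times V}$ with $(\Sigma^{-1})_{ij}=0$ whenever $i\ne j$ and $ij\notin E$. A matrix in $M_G$ is determined by its entries $\Sigma_{ij}$ with $i=j$ or $ij\in E$, and $d\Sigma$ denotes Lebesgue measure in these entries. For a positive definite $q\times q$ matrix $\Phi$ and $a>q-1$, the inverse Wishart law $\mathcal{IW}(\Phi,a)$ has density $$\frac{|\Phi|^{a/2}}{2^{aq/2}\Gamma_q(a/2)}\,|\Sigma|^{-(a+q+1)/2}\exp\{-\tfrac12\operatorname{tr}(\Phi\Sigma^{-1})\},\qquad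 \Gamma_q(b)=\pi^{q(q-1)/4}\prod_{i=0}^{q-1}\Gamma(b-\tfrac i2).$$ The normalizing constant of the normal inverse Wishart law ($\Sigma\sim\mathcal{IW}(\Phi,a)$ and $m\mid\Sigma\sim\mathcal N(\mu,\frac1\nu\Sigma)$) is $$\kappa(a,\Phi,\nu)=\frac{2^{aq/2}\,\Gamma_q(a/2)}{|\Phi|^{a/2}}\cdot\frac{(2\pi)^{q/2}}{\nu^{q/2}} .$$ Let $\mu\in\mathbb R^V$, $\nu>0$, $\vartheta>p-1$, and let $\Phi$ be a matrix with $\Phi_Q$ symmetric positive definite for every clique $Q$. For $A\subseteq V$ put $\vartheta_A=\vartheta-(p-|A|)$, the degrees of freedom of the $A$-marginal of an inverse Wishart law on $\mathbb R^{V\times V}$ with $\vartheta$ degrees of freedom. The hyper normal inverse Wishart law $\mathcal{NIW}_G(\mu,\nu,\Phi,\vartheta)$ on $\mathbb R^V\times M_G$ has density with respect to $dm\,d\Sigma$ $$\mathcal{NIW}_G(m,\Sigma\mid\mu,\nu,\Phi,\vartheta)=\mathcal N\big(m\mid\mu,\tfrac1\nu\Sigma\big)\;\frac{\prod_{Q\in\mathcal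 Q}\mathcal{IW}(\Sigma_Q\mid\Phi_Q,\vartheta_Q)}{\prod_{S\in\mathcal S}\mathcal{IW}(\Sigma_S\mid\Phi_S,\vartheta_S)} .$$ Let $$\kappa_G(\vartheta,\Phi,\nu)=\frac{\prod_{Q\in\mathcal Q}\kappa(\vartheta_Q,\Phi_Q,\nu)}{\prod_{S\in\mathcal S}\kappa(\vartheta_S,\Phi_S,\nu)} .$$ **Claim.** The above is a probability density on $\mathbb R^V\times M_G$. Let $n\ge 0$ and let $x^{(n)}=(x^1,\dots,x^n)$ be vectors in $\mathbb R^V$. Let $\bar x$ be their mean (the terms with $\bar x$ are absent if $n=0$), put $W=\sum_i(x^i-\bar x)(x^i-\bar x)'$, and $$\nu^*=\nu+n,\quad \mu^*=\frac{\nu\mu+n\bar x}{\nu^*},\quad \vartheta^*=\vartheta+n,\quad \Phi^*=\Phi+W+\frac{\nu n}{\nu^*}(\mu-\bar x)(\mu-\bar x)' .$$ Then the marginal likelihood $$f(x^{(n)}\mid G)=\int_{M_G}\int_{\mathbb R^V}\prod_{i=1}^n\mathcal N(x^i\mid m,\Sigma)\;\mathcal{NIW}_G(m,\Sigma\mid\mu,\nu,\Phi,\vartheta)\,dm\,d\Sigma$$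 exists (the integrand is integrable), and $$f(x^{(n)}\mid G)=(2\pi)^{-np/2}\,\frac{\kappa_G(\vartheta^*,\Phi^*,\nu^*)}{\kappa_G(\vartheta,\Phi,\nu)} .$$ Moreover the starred parameters are the posterior ones: for all $m\in\mathbb R^V$ and $\Sigma\in M_G$, $$\prod_{i=1}^n\mathcal N(x^i\mid m,\Sigma)\;\mathcal{NIW}_G(m,\Sigma\mid\mu,\nu,\Phi,\vartheta)=f(x^{(n)}\mid G)\;\mathcal{NIW}_G(m,\Sigma\mid\mu^*,\nu^*,\Phi^*,\vartheta^*).$$ -/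

import Mathlib

open MeasureTheory
open scoped Matrix

noncomputable section

namespace HyperNIW

/-! ### Decomposable graphs, cliques, junction trees -/

section Graphs

variable {V : Type*} [Fintype V] [DecidableEq V]

/-- `(A, B)` is a decomposition of the subgraph of `G` induced by `A ∪ B`: the intersection
`A ∩ B` is complete, and every path inside `A ∪ B` between a node of `A` and a node of `B`
meets `A ∩ B`. -/
def IsDecomposition (G : SimpleGraph V) (A B : Finset V) : Prop :=
  G.IsClique (↑(A ∩ B) : Set V) ∧
    ∀ a ∈ A, ∀ b ∈ B, ∀ w : G.Walk a b, w.IsPath → (∀ v ∈ w.support, v ∈ A ∪ B) →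
      ∃ v ∈ w.support, v ∈ A ∩ B

/-- The subgraph of `G` induced by the node set is decomposable: it is complete, or it has a
decomposition `(A, B)` such that the subgraphs induced by `A` and by `B` are decomposable. -/
inductive IsDecomposableOn (G : SimpleGraph V) : Finset V → Prop
  | complete (U : Finset V) (hU : G.IsClique (↑U : Set V)) : IsDecomposableOn G U
  | decompose (A B : Finset V) (hAB : IsDecomposition G A B)
      (hA : IsDecomposableOn G A) (hB : IsDecomposableOn G B) : IsDecomposableOn G (A ∪ B)

/-- A decomposable graph. -/
def IsDecomposable (G : SimpleGraph V) : Prop := IsDecomposableOn G Finset.univ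

/-- The cliques of `G`: the complete node sets that are maximal under inclusion. -/
abbrev Cliques (G : SimpleGraph V) : Type _ :=
  {Q : Finset V // Maximal (fun U : Finset V => G.IsClique (↑U : Set V)) Q}

/-- `T` is a junction tree of `G`: a tree whose nodes are the cliques of `G`, such that the
intersection of two cliques is contained in every clique on the path between them. -/
structure IsJunctionTree (G : SimpleGraph V) (T : SimpleGraph (Cliques G)) : Prop where
  isTree : T.IsTree
  inter_subset : ∀ (P Q : Cliques G) (w : T.Walk P Q), w.IsPath →
    ∀ R ∈ w.support, P.1 ∩ Q.1 ⊆ R.1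

/-- The separator attached to an edge of a junction tree: the intersection of its two cliques. -/
def sep {G : SimpleGraph V} (e : Sym2 (Cliques G)) : Finset V :=
  Sym2.lift ⟨fun P Q => P.1 ∩ Q.1, fun P Q => Finset.inter_comm P.1 Q.1⟩ e

open Classical in
/-- The ratio `∏_Q F Q / ∏_S F S`: the first product is over the cliques of `G`, the second over
the separators of the junction tree `T`, each taken once for every edge of `T` giving it. -/
def cliqueSepRatio {G : SimpleGraph V} (T : SimpleGraph (Cliques G)) (F : Finset V → ℝ) : ℝ :=
  (∏ Q : Cliques G, F Q.1) / ∏ e ∈ T.edgeFinset, F (sep e)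

end Graphs

/-! ### Normal, inverse Wishart and normal inverse Wishart distributions -/

section Densities

variable {ι : Type*} [Fintype ι] [DecidableEq ι]

/-- The density at `x` of the normal distribution with mean `m` and covariance matrix `Sig`. -/
def normalPDF (m : ι → ℝ) (Sig : Matrix ι ι ℝ) (x : ι → ℝ) : ℝ :=
  (2 * Real.pi) ^ (-(Fintype.card ι : ℝ) / 2) * Sig.det ^ (-(1 : ℝ) / 2) *
    Real.exp (-(1 / 2) * ((x - m) ⬝ᵥ (Sig⁻¹ *ᵥ (x - m))))

/-- The multivariate gamma function `Γ_q(a) = π^{q(q-1)/4} ∏_{i<q} Γ(a - i/2)`. -/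
def multiGamma (q : ℕ) (a : ℝ) : ℝ :=
  Real.pi ^ ((q : ℝ) * ((q : ℝ) - 1) / 4) * ∏ i ∈ Finset.range q, Real.Gamma (a - (i : ℝ) / 2)

/-- The density at `Sig` of the inverse Wishart distribution `IW(Φ, a)` with `a` degrees of
freedom. -/
def invWishartPDF (Φ : Matrix ι ι ℝ) (a : ℝ) (Sig : Matrix ι ι ℝ) : ℝ :=
  Φ.det ^ (a / 2) / (2 ^ (a * (Fintype.card ι : ℝ) / 2) * multiGamma (Fintype.card ι) (a / 2)) *
    Sig.det ^ (-(a + (Fintype.card ι : ℝ) + 1) / 2) *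
    Real.exp (-(1 / 2) * (Φ * Sig⁻¹).trace)

/-- The normalizing constant `κ(a, Φ, ν)` of the normal inverse Wishart density, that is, of
`|Sig|^{-1/2} exp{-(ν/2)(m-μ)'Sig⁻¹(m-μ)} |Sig|^{-(a+q+1)/2} exp{-(1/2) tr(Φ Sig⁻¹)}`. -/
def niwConst (a : ℝ) (Φ : Matrix ι ι ℝ) (ν : ℝ) : ℝ :=
  2 ^ (a * (Fintype.card ι : ℝ) / 2) * multiGamma (Fintype.card ι) (a / 2) / Φ.det ^ (a / 2) *
    ((2 * Real.pi) ^ ((Fintype.card ι : ℝ) / 2) / ν ^ ((Fintype.card ι : ℝ) / 2))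

end Densities

/-! ### The hyper normal inverse Wishart law -/

section Law

variable {V : Type*} [Fintype V] [DecidableEq V]

/-- The principal submatrix with rows and columns in `A`. -/
def block (M : Matrix V V ℝ) (A : Finset V) : Matrix A A ℝ :=
  M.submatrix Subtype.val Subtype.val

/-- The degrees of freedom of the `A`-marginal of an inverse Wishart matrix with index set `V`
and `ϑ` degrees of freedom: `ϑ - (p - |A|)` where `p = |V|`. -/
def margDof (ϑ : ℝ) (A : Finset V) : ℝ := ϑ - ((Fintype.card V : ℝ) - (A.card : ℝ))

/-- The space `M_G` of covariance matrices of the Gaussian graphical model of `G`: the symmetric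
positive definite matrices whose inverse vanishes at every non-edge. -/
abbrev CovSpace (G : SimpleGraph V) : Type _ :=
  {Sig : Matrix V V ℝ // Sig.PosDef ∧ ∀ i j, i ≠ j → ¬ G.Adj i j → Sig⁻¹ i j = 0}

/-- The free coordinates of `M_G`: the diagonal positions and the edges of `G`. -/
abbrev FreeIdx (G : SimpleGraph V) : Type _ := {e : Sym2 V // e.IsDiag ∨ e ∈ G.edgeSet}

/-- The free coordinates `(Sig_ij)`, `i = j` or `ij` an edge, of a matrix in `M_G`. -/
def freeCoord (G : SimpleGraph V) (Sig : CovSpace G) (e : FreeIdx G) : ℝ :=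
  Sym2.lift ⟨fun i j => Sig.1 i j, fun i j => (Sig.2.1.isHermitian.apply i j).symm⟩ e.1

open scoped MatrixOrder Matrix.Norms.L2Operator in
/-- A matrix in `M_G` is determined by its free coordinates. -/
theorem freeCoord_injective (G : SimpleGraph V) : Function.Injective (freeCoord G) := by
  intro A B h
  have hent : ∀ i j, (i = j ∨ G.Adj i j) → A.1 i j = B.1 i j := by
    intro i j hij
    have := congrFun h ⟨s(i, j), by simpa using hij⟩
    simpa [freeCoord] using this
  apply Subtype.ext
  obtain ⟨A, hA, hA'⟩ := A
  obtain ⟨B, hB, hB'⟩ := B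
  simp only at hent ⊢
  have dA : IsUnit A.det := (Matrix.isUnit_iff_isUnit_det A).1 hA.isUnit
  have dB : IsUnit B.det := (Matrix.isUnit_iff_isUnit_det B).1 hB.isUnit
  obtain ⟨D, hD⟩ : ∃ D, D = B⁻¹ - A⁻¹ := ⟨_, rfl⟩
  have h1 : A - B = A * D * B := by
    rw [hD, Matrix.mul_sub, Matrix.sub_mul, Matrix.mul_assoc, Matrix.nonsing_inv_mul _ dB,
      Matrix.mul_nonsing_inv _ dA]
    simp
  have hDt : star D = D := by
    rw [hD, star_sub]
    exact congrArg₂ _ hB.inv.isHermitian.eq hA.inv.isHermitian.eq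
  have h0 : (A * D * B * D).trace = 0 := by
    rw [← h1, Matrix.trace]
    refine Finset.sum_eq_zero fun i _ => ?_
    rw [Matrix.diag_apply, Matrix.mul_apply]
    refine Finset.sum_eq_zero fun j _ => ?_
    by_cases hij : i = j ∨ G.Adj i j
    · simp [hent i j hij]
    · push Not at hij
      have n1 : ¬ G.Adj j i := fun h => hij.2 h.symm
      simp [hD, hA' j i (Ne.symm hij.1) n1, hB' j i (Ne.symm hij.1) n1]
  obtain ⟨P, hP, hPA⟩ :=
    CStarAlgebra.isStrictlyPositive_iff_eq_star_mul_self.mp hA.isStrictlyPositive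
  obtain ⟨Q, hQ, hQB⟩ :=
    CStarAlgebra.isStrictlyPositive_iff_eq_star_mul_self.mp hB.isStrictlyPositive
  have h2 : ((P * D * star Q) * star (P * D * star Q)).trace = 0 := by
    rw [← h0, hPA, hQB]
    simp only [star_mul, star_star, hDt, mul_assoc]
    rw [Matrix.trace_mul_comm]
    simp only [mul_assoc]
    rw [Matrix.trace_mul_comm (star P)]
    simp only [mul_assoc]
    rw [Matrix.trace_mul_comm P]
    simp only [mul_assoc]
  have h3 : P * D * star Q = 0 := Matrix.trace_mul_conjTranspose_self_eq_zero_iff.1 h2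
  have h4 : A - B = 0 := by
    rw [h1, hPA, hQB]
    calc star P * P * D * (star Q * Q) = star P * (P * D * star Q) * Q := by
          simp only [mul_assoc]
      _ = 0 := by rw [h3]; simp
  exact sub_eq_zero.1 h4

instance (G : SimpleGraph V) : MeasurableSpace (CovSpace G) := borel _

instance (G : SimpleGraph V) : BorelSpace (CovSpace G) := ⟨rfl⟩

open Classical in
/-- The reference measure `dSig` on `M_G`: Lebesgue measure in the free coordinates. -/
def covMeasure (G : SimpleGraph V) : Measure (CovSpace G) :=
  (volume : Measure (FreeIdx G → ℝ)).comap (freeCoord G)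

/-- The density of the hyper inverse Wishart law on `M_G`: the clique/separator ratio of the
consistent inverse Wishart densities of the blocks. -/
def hyperInvWishartPDF {G : SimpleGraph V} (T : SimpleGraph (Cliques G)) (Φ : Matrix V V ℝ)
    (ϑ : ℝ) (Sig : Matrix V V ℝ) : ℝ :=
  cliqueSepRatio T fun A => invWishartPDF (block Φ A) (margDof ϑ A) (block Sig A)

/-- The density, with respect to `dm dSig`, of the hyper normal inverse Wishart law:
`Sig` is hyper inverse Wishart and, given `Sig`, the mean `m` is normal `N(μ, (1/ν) Sig)`. -/
def hyperNIWPDF {G : SimpleGraph V} (T : SimpleGraph (Cliques G)) (μ : V → ℝ) (ν : ℝ)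
    (Φ : Matrix V V ℝ) (ϑ : ℝ) (m : V → ℝ) (Sig : Matrix V V ℝ) : ℝ :=
  normalPDF μ ((1 / ν) • Sig) m * hyperInvWishartPDF T Φ ϑ Sig

/-- The constant `κ_G(ϑ, Φ, ν)`: the clique/separator ratio of the normal inverse Wishart
normalizing constants. -/
def kappa {G : SimpleGraph V} (T : SimpleGraph (Cliques G)) (ϑ : ℝ) (Φ : Matrix V V ℝ)
    (ν : ℝ) : ℝ :=
  cliqueSepRatio T fun A => niwConst (margDof ϑ A) (block Φ A) ν

/-! ### The data and the updated parameters -/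

variable {n : ℕ}

/-- The joint density of the sample `x 0, …, x (n-1)`, independent with law `N(m, Sig)`. -/
def likelihood (x : Fin n → V → ℝ) (m : V → ℝ) (Sig : Matrix V V ℝ) : ℝ :=
  ∏ i, normalPDF m Sig (x i)

/-- The marginal likelihood `f(x | G)`: the likelihood integrated against the hyper normal inverse
Wishart prior. -/
def marginalLikelihood {G : SimpleGraph V} (T : SimpleGraph (Cliques G)) (μ : V → ℝ) (ν : ℝ)
    (Φ : Matrix V V ℝ) (ϑ : ℝ) (x : Fin n → V → ℝ) : ℝ :=
  ∫ Sig : CovSpace G, ∫ m : V → ℝ,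
    likelihood x m Sig.1 * hyperNIWPDF T μ ν Φ ϑ m Sig.1 ∂volume ∂(covMeasure G)

/-- The sample mean. -/
def sampleMean (x : Fin n → V → ℝ) : V → ℝ := (1 / (n : ℝ)) • ∑ i, x i

/-- The scatter matrix `S = ∑ᵢ (xⁱ - x̄)(xⁱ - x̄)'`. -/
def scatter (x : Fin n → V → ℝ) : Matrix V V ℝ :=
  ∑ i, Matrix.vecMulVec (x i - sampleMean x) (x i - sampleMean x)

/-- `ν* = ν + n`. -/
def nuStar (n : ℕ) (ν : ℝ) : ℝ := ν + n

/-- `ϑ* = ϑ + n`. -/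
def dofStar (n : ℕ) (ϑ : ℝ) : ℝ := ϑ + n

/-- `μ* = (ν μ + n x̄) / ν*`. -/
def muStar (μ : V → ℝ) (ν : ℝ) (x : Fin n → V → ℝ) : V → ℝ :=
  (1 / nuStar n ν) • (ν • μ + (n : ℝ) • sampleMean x)

/-- `Φ* = Φ + S + (ν n / ν*) (μ - x̄)(μ - x̄)'`. -/
def phiStar (μ : V → ℝ) (ν : ℝ) (Φ : Matrix V V ℝ) (x : Fin n → V → ℝ) : Matrix V V ℝ :=
  Φ + scatter x +
    (ν * n / nuStar n ν) • Matrix.vecMulVec (μ - sampleMean x) (μ - sampleMean x)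

end Law

end HyperNIW

end

/-!
The argument follows a perfect elimination order of the nodes, in which everything reduces to adding
one row and column to a positive definite block.

**Elimination sequences.** An elimination sequence (`IsElim`) is a list of pairs `(v, N)`: the new
node `v` is joined to the set `N`, which is empty or lies inside the family `N' ∪ {v'}` of an
earlier pair, so that the nodes of `N` are already joined to each other. A junction tree yields such
a sequence (`IsJunctionTree.exists_isElim`): the cliques are visited along the tree, and by the
running intersection property the nodes of a new clique seen before are those of its separator.
Along the sequence the ratio `∏ F(Q) / ∏ F(S)` over cliques and separators telescopes to
`∏ F(N ∪ {v}) / F(N)`, for every `F` with `F(∅) = 1` that does not vanish on complete sets.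

**Normalization.** For `F` the inverse Wishart density, one factor of this product is a conditional
density of the row `v` given the block `N`: with `l` the Schur complement and `β` the regression
coefficients of `v` on `N`, it is an inverse gamma density in `l` times a Gaussian density in `β`,
times the Jacobian of the change of variables (`invWishartPDF_border`). So the row integrates to one
(`lintegral_border`), and integrating out the rows in turn shows that the hyper inverse Wishart
density integrates to one over the partial matrices with positive Schur complements
(`IsElim.lmarginal_elimDensity`). The inverse Wishart integral itself is not
needed: the multivariate gamma function obeys the recursion of the rows (`multiGamma_succ`).

**The space `M_G`.** The partial matrices with positive Schur complements are exactly the free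
coordinates of matrices in `M_G` (`IsElim.exists_completion`): the row `v` is completed by
regressing `v` on `N` only. This adds `b b' / l` to the inverse, where `b` is supported on
`N ∪ {v}`, so the inverse vanishes at the non-edges. The same recursion shows that, on `M_G`, the
determinant is the ratio of the determinants of the blocks and the inverse is the alternating sum of
their inverses. Since `M_G` is Polish, the injective coordinate map is a measurable embedding, and
integrals over `M_G` become integrals over coordinates (`lintegral_covMeasure`).

**Conjugacy.** Completing the square in `m` (`sum_sq_add_prior`) turns likelihood times normal prior
into the posterior normal density times `|Sig|^(-n/2) exp(-tr((Φ* - Φ) Sig⁻¹)/2)` up to constants.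
By the two identities on `M_G` this factor is again a clique/separator ratio, and it updates
each inverse Wishart factor separately (`likelihood_mul_hyperNIWPDF`). Integrating against the
normalized posterior density gives the marginal likelihood.
-/

open MeasureTheory
open scoped Matrix

noncomputable section

namespace HyperNIW

/-! ### Bordered matrices -/

section Border

variable {ι : Type*} [Fintype ι] [DecidableEq ι]

/-- The symmetric matrix obtained from `A` by adding one row and one column, with off-diagonal
part `z` and diagonal entry `t`. -/
def border (A : Matrix ι ι ℝ) (z : ι → ℝ) (t : ℝ) : Matrix (ι ⊕ Unit) (ι ⊕ Unit) ℝ :=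
  Matrix.fromBlocks A (Matrix.replicateCol Unit z) (Matrix.replicateRow Unit z)
    (Matrix.of fun _ _ => t)

lemma det_border {A : Matrix ι ι ℝ} (hA : A.PosDef) (z : ι → ℝ) (t : ℝ) :
    (border A z t).det = A.det * (t - z ⬝ᵥ A⁻¹ *ᵥ z) := by
  let := hA.isUnit.invertible
  rw [border, Matrix.det_fromBlocks₁₁, Matrix.det_unique (n := Unit),
    Matrix.invOf_eq_nonsing_inv]
  congr 1
  simp [Matrix.mul_apply, dotProduct, Matrix.mulVec, Finset.sum_mul, Finset.mul_sum, mul_assoc]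
  exact Finset.sum_comm

omit [Fintype ι] [DecidableEq ι] in
lemma isHermitian_real_iff {M : Matrix ι ι ℝ} : M.IsHermitian ↔ Mᵀ = M := by
  rw [Matrix.IsHermitian, Matrix.conjTranspose_eq_transpose_of_trivial]

lemma complete_square {A : Matrix ι ι ℝ} (hs : Aᵀ = A) (hu : IsUnit A.det) (z c : ι → ℝ) :
    c ⬝ᵥ A *ᵥ c - 2 * (z ⬝ᵥ c) =
      (c - A⁻¹ *ᵥ z) ⬝ᵥ A *ᵥ (c - A⁻¹ *ᵥ z) - z ⬝ᵥ A⁻¹ *ᵥ z := by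
  have h1 : A *ᵥ (A⁻¹ *ᵥ z) = z := by
    rw [Matrix.mulVec_mulVec, Matrix.mul_nonsing_inv _ hu, Matrix.one_mulVec]
  have h2 : (A⁻¹ *ᵥ z) ⬝ᵥ A *ᵥ c = z ⬝ᵥ c := by
    rw [Matrix.dotProduct_mulVec, ← Matrix.mulVec_transpose, hs, h1]
  rw [Matrix.mulVec_sub, sub_dotProduct, dotProduct_sub, dotProduct_sub, h1, h2,
    dotProduct_comm c z, dotProduct_comm _ z]
  ring

omit [DecidableEq ι] in
lemma border_quad (A : Matrix ι ι ℝ) (z : ι → ℝ) (t : ℝ) (x : ι ⊕ Unit → ℝ) :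
    x ⬝ᵥ border A z t *ᵥ x =
      (x ∘ Sum.inl) ⬝ᵥ A *ᵥ (x ∘ Sum.inl) + 2 * x (Sum.inr ()) * (z ⬝ᵥ (x ∘ Sum.inl)) +
        t * x (Sum.inr ()) ^ 2 := by
  rw [border, Matrix.fromBlocks_mulVec]
  simp only [dotProduct, Fintype.sum_sum_type, Sum.elim_inl, Sum.elim_inr, Pi.add_apply,
    Matrix.mulVec, Function.comp, Matrix.replicateCol_apply, Matrix.replicateRow_apply,
    Finset.univ_unique, Finset.sum_singleton, Matrix.of_apply, mul_add, Finset.sum_add_distrib,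
    PUnit.default_eq_unit, Finset.mul_sum]
  have : ∀ i, x (Sum.inl i) * (z i * x (Sum.inr ())) + x (Sum.inr ()) * (z i * x (Sum.inl i)) =
      2 * x (Sum.inr ()) * (z i * x (Sum.inl i)) := fun i => by ring
  simp_rw [← this, Finset.sum_add_distrib]
  ring

omit [Fintype ι] [DecidableEq ι] in
lemma border_isHermitian {A : Matrix ι ι ℝ} (hA : A.IsHermitian) (z : ι → ℝ) (t : ℝ) :
    (border A z t).IsHermitian := by
  refine Matrix.IsHermitian.fromBlocks hA ?_ ?_
  · ext i j; simp
  · ext i j; simp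

lemma border_posDef_iff {A : Matrix ι ι ℝ} (hA : A.PosDef) (z : ι → ℝ) (t : ℝ) :
    (border A z t).PosDef ↔ 0 < t - z ⬝ᵥ A⁻¹ *ᵥ z := by
  constructor
  · intro h
    have := h.det_pos
    rw [det_border hA] at this
    exact pos_of_mul_pos_right this hA.det_pos.le
  · intro h
    refine Matrix.PosDef.of_dotProduct_mulVec_pos (border_isHermitian hA.1 z t) fun x hx => ?_
    rw [star_trivial, border_quad]
    have hs := isHermitian_real_iff.1 hA.1
    have hu := (Matrix.isUnit_iff_isUnit_det A).1 hA.isUnit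
    have key := complete_square hs hu (x (Sum.inr ()) • z) (-(x ∘ Sum.inl))
    simp only [Matrix.mulVec_neg, neg_dotProduct, dotProduct_neg, smul_dotProduct, smul_eq_mul,
      Matrix.mulVec_smul, dotProduct_smul] at key
    have hnn := hA.posSemidef.dotProduct_mulVec_nonneg
      (-(x ∘ Sum.inl) - x (Sum.inr ()) • A⁻¹ *ᵥ z)
    rw [star_trivial] at hnn
    by_cases h0 : x (Sum.inr ()) = 0
    · have : x ∘ Sum.inl ≠ 0 := by
        rintro h1
        apply hx
        ext i
        rcases i with i | ⟨⟩
        · exact congrFun h1 i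
        · exact h0
      have := hA.dotProduct_mulVec_pos this
      rw [star_trivial] at this
      simpa [h0] using this
    · have : 0 < (t - z ⬝ᵥ A⁻¹ *ᵥ z) * x (Sum.inr ()) ^ 2 := by positivity
      nlinarith

lemma border_inv {A : Matrix ι ι ℝ} (hA : A.PosDef) (z : ι → ℝ) (t : ℝ)
    (h : 0 < t - z ⬝ᵥ A⁻¹ *ᵥ z) :
    (border A z t)⁻¹ = border (A⁻¹ + (t - z ⬝ᵥ A⁻¹ *ᵥ z)⁻¹ •
        Matrix.vecMulVec (A⁻¹ *ᵥ z) (A⁻¹ *ᵥ z))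
      (-(t - z ⬝ᵥ A⁻¹ *ᵥ z)⁻¹ • A⁻¹ *ᵥ z) (t - z ⬝ᵥ A⁻¹ *ᵥ z)⁻¹ := by
  have hs := isHermitian_real_iff.1 hA.1
  have hu := (Matrix.isUnit_iff_isUnit_det A).1 hA.isUnit
  have h1 : A *ᵥ (A⁻¹ *ᵥ z) = z := by
    rw [Matrix.mulVec_mulVec, Matrix.mul_nonsing_inv _ hu, Matrix.one_mulVec]
  have hs' : (A⁻¹)ᵀ = A⁻¹ := by rw [Matrix.transpose_nonsing_inv, hs]
  set l := t - z ⬝ᵥ A⁻¹ *ᵥ z with hl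
  set β := A⁻¹ *ᵥ z with hβ
  have hl0 : l ≠ 0 := h.ne'
  apply Matrix.inv_eq_right_inv
  rw [border, border, Matrix.fromBlocks_multiply, ← Matrix.fromBlocks_one]
  congr 1
  · rw [Matrix.mul_add, Matrix.mul_nonsing_inv _ hu, Matrix.mul_smul, Matrix.mul_vecMulVec, h1]
    ext i j
    simp [Matrix.mul_apply, Matrix.vecMulVec_apply]
    ring
  · rw [← Matrix.replicateCol_mulVec, Matrix.mulVec_smul, h1]
    ext i j
    simp [Matrix.mul_apply]
    ring
  · ext i j
    have e1 : (z ᵥ* A⁻¹) j = β j := by rw [← Matrix.mulVec_transpose, hs']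
    have e2 : z ⬝ᵥ β = t - l := by rw [hl]; ring
    rw [Matrix.mul_add, ← Matrix.replicateRow_vecMul, Matrix.mul_smul]
    simp only [Matrix.add_apply, Matrix.replicateRow_apply, e1, Matrix.smul_apply,
      Matrix.mul_apply, Matrix.vecMulVec_apply, Finset.univ_unique, Finset.sum_singleton,
      Matrix.of_apply, smul_eq_mul, ← mul_assoc, ← Finset.sum_mul, Pi.smul_apply, Matrix.zero_apply]
    rw [show ∑ i, z i * β i = t - l from e2]
    field_simp
    ring
  · ext i j
    have e2 : z ⬝ᵥ β = t - l := by rw [hl]; ring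
    simp only [Matrix.add_apply, Matrix.mul_apply, Matrix.replicateRow_apply,
      Matrix.replicateCol_apply, Pi.smul_apply, smul_eq_mul, Finset.univ_unique,
      Finset.sum_singleton, Matrix.of_apply, Matrix.one_apply, Subsingleton.elim i j, if_true]
    have : ∑ x, z x * (-l⁻¹ * β x) = -l⁻¹ * (z ⬝ᵥ β) := by
      rw [dotProduct, Finset.mul_sum]; exact Finset.sum_congr rfl fun _ _ => by ring
    rw [this, e2]
    field_simp
    ring

lemma trace_border_mul_inv {A : Matrix ι ι ℝ} (hA : A.PosDef) (z : ι → ℝ) (t : ℝ)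
    (h : 0 < t - z ⬝ᵥ A⁻¹ *ᵥ z) (F : Matrix ι ι ℝ) (f : ι → ℝ) (φ : ℝ) :
    (border F f φ * (border A z t)⁻¹).trace = (F * A⁻¹).trace +
      (φ - 2 * (f ⬝ᵥ A⁻¹ *ᵥ z) + (A⁻¹ *ᵥ z) ⬝ᵥ F *ᵥ (A⁻¹ *ᵥ z)) / (t - z ⬝ᵥ A⁻¹ *ᵥ z) := by
  rw [border_inv hA z t h]
  set l := t - z ⬝ᵥ A⁻¹ *ᵥ z
  set β := A⁻¹ *ᵥ z
  have e1 : (F * Matrix.vecMulVec β β).trace = β ⬝ᵥ F *ᵥ β := by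
    rw [Matrix.mul_vecMulVec, Matrix.trace_vecMulVec, dotProduct_comm]
  have e2 : ∀ a b : ι → ℝ, (Matrix.replicateCol Unit a * Matrix.replicateRow Unit b).trace =
      a ⬝ᵥ b := by
    intro a b; simp [Matrix.trace, Matrix.mul_apply, dotProduct]
  have e4 : ∀ (X : Matrix ι ι ℝ) (Y : Matrix ι Unit ℝ) (Z : Matrix Unit ι ℝ)
      (W : Matrix Unit Unit ℝ), (Matrix.fromBlocks X Y Z W).trace = X.trace + W.trace := by
    intro X Y Z W; simp [Matrix.trace, Fintype.sum_sum_type]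
  rw [border, border, Matrix.fromBlocks_multiply, e4, Matrix.trace_add,
    Matrix.trace_add, Matrix.mul_add, Matrix.trace_add, Matrix.mul_smul, Matrix.trace_smul, e1,
    e2]
  have e3 : (Matrix.replicateRow Unit f * Matrix.replicateCol Unit (-l⁻¹ • β)).trace =
      -l⁻¹ * (f ⬝ᵥ β) := by
    rw [Matrix.trace_mul_comm, e2, dotProduct_comm, dotProduct_smul, smul_eq_mul]
  rw [e3, dotProduct_smul]
  simp [Matrix.trace, Matrix.mul_apply]
  ring

end Border

/-! ### Gaussian and inverse gamma integrals, and the bordering step -/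

section Integrals

variable {ι : Type*} [Fintype ι] [DecidableEq ι]

lemma lintegral_comp_mulVec {M : Matrix ι ι ℝ} (hM : M.det ≠ 0) {f : (ι → ℝ) → ENNReal}
    (hf : Measurable f) :
    ∫⁻ u, f (M *ᵥ u) = ENNReal.ofReal |M.det|⁻¹ * ∫⁻ u, f u := by
  have h := Real.map_matrix_volume_pi_eq_smul_volume_pi hM
  have hm : Measurable (Matrix.toLin' M) := (LinearMap.continuous_on_pi _).measurable
  calc ∫⁻ u, f (M *ᵥ u) = ∫⁻ u, f (Matrix.toLin' M u) := by simp only [Matrix.toLin'_apply]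
    _ = ∫⁻ u, f u ∂(Measure.map (Matrix.toLin' M) volume) := (lintegral_map hf hm).symm
    _ = _ := by rw [h, lintegral_smul_measure, abs_inv, smul_eq_mul]

/-- A nonnegative function whose Bochner integral is a nonzero number has that number as its
lower Lebesgue integral: it cannot fail to be integrable. -/
lemma lintegral_ofReal_of_integral_eq {α : Type*} [MeasurableSpace α] {μ : Measure α} {f : α → ℝ}
    {c : ℝ} (hf : 0 ≤ᵐ[μ] f) (hc : c ≠ 0) (h : ∫ x, f x ∂μ = c) :
    ∫⁻ x, ENNReal.ofReal (f x) ∂μ = ENNReal.ofReal c := by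
  have hi : Integrable f μ := by
    by_contra hn
    exact hc (h ▸ integral_undef hn)
  rw [← h, ofReal_integral_eq_lintegral_ofReal hi hf]

omit [DecidableEq ι] in
lemma lintegral_standard_gaussian :
    ∫⁻ u : ι → ℝ, ENNReal.ofReal (Real.exp (-(1 / 2) * (u ⬝ᵥ u))) =
      ENNReal.ofReal ((2 * Real.pi) ^ ((Fintype.card ι : ℝ) / 2)) := by
  refine lintegral_ofReal_of_integral_eq (.of_forall fun _ => (Real.exp_pos _).le)
    (by positivity) ?_
  have h := GaussianFourier.integral_rexp_neg_mul_sq_norm (V := EuclideanSpace ℝ ι)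
    (b := 1 / 2) (by norm_num)
  rw [← (PiLp.volume_preserving_toLp ι).integral_comp
    (MeasurableEquiv.toLp 2 (ι → ℝ)).measurableEmbedding] at h
  rw [finrank_euclideanSpace] at h
  rw [show 2 * Real.pi = Real.pi / (1 / 2) by ring, ← h]
  refine integral_congr_ae (.of_forall fun u => ?_)
  have h2 := EuclideanSpace.real_norm_sq_eq (WithLp.toLp 2 u)
  simp only [h2, dotProduct, sq]

open scoped MatrixOrder Matrix.Norms.L2Operator in
lemma exists_factor_of_posDef {P : Matrix ι ι ℝ} (hP : P.PosDef) :
    ∃ B : Matrix ι ι ℝ, P = Bᵀ * B ∧ |B.det| = P.det ^ (1 / 2 : ℝ) ∧ B.det ≠ 0 := by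
  obtain ⟨B, hB, hPB⟩ :=
    CStarAlgebra.isStrictlyPositive_iff_eq_star_mul_self.mp hP.isStrictlyPositive
  rw [Matrix.star_eq_conjTranspose, Matrix.conjTranspose_eq_transpose_of_trivial] at hPB
  refine ⟨B, hPB, ?_, ((Matrix.isUnit_iff_isUnit_det B).1 hB).ne_zero⟩
  rw [hPB, Matrix.det_mul, Matrix.det_transpose, ← Real.sqrt_eq_rpow, Real.sqrt_mul_self_eq_abs]

lemma lintegral_gaussian {P : Matrix ι ι ℝ} (hP : P.PosDef) (c : ι → ℝ) :
    ∫⁻ u : ι → ℝ, ENNReal.ofReal (Real.exp (-(1 / 2) * ((u - c) ⬝ᵥ P *ᵥ (u - c)))) =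
      ENNReal.ofReal ((2 * Real.pi) ^ ((Fintype.card ι : ℝ) / 2) * P.det ^ (-(1 / 2) : ℝ)) := by
  obtain ⟨B, hPB, hdet, hB0⟩ := exists_factor_of_posDef hP
  rw [lintegral_sub_right_eq_self
    (fun u : ι → ℝ => ENNReal.ofReal (Real.exp (-(1 / 2) * (u ⬝ᵥ P *ᵥ u)))) c]
  have hq : ∀ u : ι → ℝ, u ⬝ᵥ P *ᵥ u = (B *ᵥ u) ⬝ᵥ (B *ᵥ u) := by
    intro u
    rw [hPB, ← Matrix.mulVec_mulVec, Matrix.dotProduct_mulVec, Matrix.vecMul_transpose]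
  simp_rw [hq]
  rw [lintegral_comp_mulVec (M := B)
    (f := fun w => ENNReal.ofReal (Real.exp (-(1 / 2) * (w ⬝ᵥ w)))) hB0
    (by simp only [dotProduct]; fun_prop), lintegral_standard_gaussian, hdet,
    ← ENNReal.ofReal_mul (by have := hP.det_pos; positivity), Real.rpow_neg hP.det_pos.le, mul_comm]

lemma lintegral_invGamma {s c : ℝ} (hs : 0 < s) (hc : 0 < c) :
    ∫⁻ t in Set.Ioi (0 : ℝ), ENNReal.ofReal (t ^ (-s - 1) * Real.exp (-(c / t))) =
      ENNReal.ofReal (Real.Gamma s * c ^ (-s)) := by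
  refine lintegral_ofReal_of_integral_eq ?_ (by have := Real.Gamma_pos_of_pos hs; positivity) ?_
  · refine (ae_restrict_mem measurableSet_Ioi).mono fun t (ht : 0 < t) => ?_
    simp only [Pi.zero_apply]
    positivity
  · have h1 := Real.integral_rpow_mul_exp_neg_mul_Ioi hs hc
    -- substitute `1 / t` for `t`
    rw [← integral_comp_rpow_Ioi _ (show (-1 : ℝ) ≠ 0 by norm_num)] at h1
    have h2 : (1 / c) ^ s * Real.Gamma s = Real.Gamma s * c ^ (-s) := by
      rw [one_div, Real.inv_rpow hc.le, Real.rpow_neg hc.le, mul_comm]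
    rw [← h2, ← h1]
    refine setIntegral_congr_fun measurableSet_Ioi fun t (ht : 0 < t) => ?_
    simp only [smul_eq_mul]
    rw [Real.rpow_neg_one, abs_neg, abs_one, one_mul, Real.inv_rpow ht.le, ← Real.rpow_neg ht.le,
      ← mul_assoc, ← Real.rpow_add ht, ← div_eq_mul_inv]
    congr 2
    ring

lemma multiGamma_pos {q : ℕ} {a : ℝ} (ha : (q : ℝ) - 1 < 2 * a) : 0 < multiGamma q a := by
  refine mul_pos (by positivity) (Finset.prod_pos fun i hi => Real.Gamma_pos_of_pos ?_)
  have : (i : ℝ) + 1 ≤ q := by exact_mod_cast Finset.mem_range.1 hi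
  linarith

lemma multiGamma_succ (q : ℕ) (a : ℝ) :
    multiGamma (q + 1) (a + 1 / 2) =
      Real.pi ^ ((q : ℝ) / 2) * Real.Gamma (a + 1 / 2) * multiGamma q a := by
  rw [multiGamma, multiGamma, Finset.prod_range_succ']
  have h : Real.pi ^ (((q + 1 : ℕ) : ℝ) * (((q + 1 : ℕ) : ℝ) - 1) / 4) =
      Real.pi ^ ((q : ℝ) / 2) * Real.pi ^ ((q : ℝ) * ((q : ℝ) - 1) / 4) := by
    rw [← Real.rpow_add Real.pi_pos]
    push_cast
    ring_nf
  have h2 : ∀ i : ℕ, a + 1 / 2 - ((i + 1 : ℕ) : ℝ) / 2 = a - (i : ℝ) / 2 := by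
    intro i; push_cast; ring
  simp_rw [h, h2]
  simp only [Nat.cast_zero, zero_div, sub_zero]
  ring

lemma invWishartPDF_pos {Φ Sig : Matrix ι ι ℝ} {a : ℝ} (hΦ : Φ.PosDef) (hS : Sig.PosDef)
    (ha : (Fintype.card ι : ℝ) - 1 < a) : 0 < invWishartPDF Φ a Sig := by
  have h1 := hΦ.det_pos
  have h2 := hS.det_pos
  have h3 := multiGamma_pos (q := Fintype.card ι) (a := a / 2) (by linarith)
  unfold invWishartPDF
  positivity

/-- The law of the Schur complement and of the regression coefficients of a bordered inverse
Wishart matrix given the matrix before bordering: an inverse gamma law and a normal law. -/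
lemma invWishartPDF_border {A F : Matrix ι ι ℝ} (hA : A.PosDef) (hF : F.PosDef) (f z : ι → ℝ)
    (φ t : ℝ) {a : ℝ} (ha : (Fintype.card ι : ℝ) - 1 < a)
    (hφ : 0 < φ - f ⬝ᵥ F⁻¹ *ᵥ f) (ht : 0 < t - z ⬝ᵥ A⁻¹ *ᵥ z) :
    invWishartPDF (border F f φ) (a + 1) (border A z t) / invWishartPDF F a A =
      A.det⁻¹ *
      (((φ - f ⬝ᵥ F⁻¹ *ᵥ f) / 2) ^ ((a + 1) / 2) / Real.Gamma ((a + 1) / 2) *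
        ((t - z ⬝ᵥ A⁻¹ *ᵥ z) ^ (-((a + 1) / 2) - 1) *
          Real.exp (-((φ - f ⬝ᵥ F⁻¹ *ᵥ f) / 2 / (t - z ⬝ᵥ A⁻¹ *ᵥ z)))) *
      ((2 * Real.pi) ^ (-(Fintype.card ι : ℝ) / 2) *
        (((t - z ⬝ᵥ A⁻¹ *ᵥ z)⁻¹ • F).det ^ (1 / 2 : ℝ) *
        Real.exp (-(1 / 2) * ((A⁻¹ *ᵥ z - F⁻¹ *ᵥ f) ⬝ᵥ ((t - z ⬝ᵥ A⁻¹ *ᵥ z)⁻¹ • F) *ᵥ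
          (A⁻¹ *ᵥ z - F⁻¹ *ᵥ f)))))) := by
  have hsq := complete_square (isHermitian_real_iff.1 hF.1)
    ((Matrix.isUnit_iff_isUnit_det F).1 hF.isUnit) f (A⁻¹ *ᵥ z)
  have hiw := (invWishartPDF_pos hF hA ha).ne'
  have hdA := hA.det_pos
  have hdF := hF.det_pos
  rw [div_eq_iff hiw]
  unfold invWishartPDF
  rw [trace_border_mul_inv hA z t ht, det_border hA, det_border hF, Matrix.det_smul,
    Matrix.smul_mulVec, dotProduct_smul, Fintype.card_sum, Fintype.card_unit]
  set l := t - z ⬝ᵥ A⁻¹ *ᵥ z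
  set m := φ - f ⬝ᵥ F⁻¹ *ᵥ f with hm
  set k := Fintype.card ι
  have e1 : φ - 2 * (f ⬝ᵥ A⁻¹ *ᵥ z) + (A⁻¹ *ᵥ z) ⬝ᵥ F *ᵥ (A⁻¹ *ᵥ z) =
      m + (A⁻¹ *ᵥ z - F⁻¹ *ᵥ f) ⬝ᵥ F *ᵥ (A⁻¹ *ᵥ z - F⁻¹ *ᵥ f) := by
    rw [hm]; linarith
  rw [e1]
  set q := (A⁻¹ *ᵥ z - F⁻¹ *ᵥ f) ⬝ᵥ F *ᵥ (A⁻¹ *ᵥ z - F⁻¹ *ᵥ f)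
  set τ := (F * A⁻¹).trace
  have hg : 0 < Real.Gamma ((a + 1) / 2) := Real.Gamma_pos_of_pos (by
    have : (0 : ℝ) ≤ k := Nat.cast_nonneg k
    linarith)
  have hmg := multiGamma_pos (q := k) (a := a / 2) (by linarith)
  have hms : multiGamma (k + 1) ((a + 1) / 2) =
      Real.pi ^ ((k : ℝ) / 2) * Real.Gamma ((a + 1) / 2) * multiGamma k (a / 2) := by
    rw [show (a + 1) / 2 = a / 2 + 1 / 2 by ring, multiGamma_succ]
  rw [hms]
  have hexp : Real.exp (-(1 / 2) * (τ + (m + q) / l)) =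
      Real.exp (-(m / 2 / l)) * Real.exp (-(1 / 2) * l⁻¹ • q) * Real.exp (-(1 / 2) * τ) := by
    rw [← Real.exp_add, ← Real.exp_add, smul_eq_mul]
    congr 1
    field_simp
    ring
  rw [hexp]
  have hl := ht
  have p1 : (F.det * m) ^ ((a + 1) / 2) = F.det ^ (a / 2) * F.det ^ (1 / 2 : ℝ) *
      m ^ ((a + 1) / 2) := by
    rw [Real.mul_rpow hdF.le hφ.le, ← Real.rpow_add hdF]; ring_nf
  have p2 : (A.det * l) ^ (-(a + 1 + ((k + 1 : ℕ) : ℝ) + 1) / 2) =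
      A.det⁻¹ * A.det ^ (-(a + k + 1) / 2) *
        (l ^ (-((a + 1) / 2) - 1) * l ^ (-(k : ℝ) / 2)) := by
    rw [Real.mul_rpow hdA.le hl.le, ← Real.rpow_neg_one, ← Real.rpow_add hdA, ← Real.rpow_add hl]
    push_cast
    ring_nf
  have p3 : (l⁻¹ ^ k * F.det) ^ (1 / 2 : ℝ) = l ^ (-(k : ℝ) / 2) * F.det ^ (1 / 2 : ℝ) := by
    rw [Real.mul_rpow (by positivity) hdF.le, ← Real.rpow_natCast, ← Real.rpow_mul (by positivity),
      Real.inv_rpow hl.le, ← Real.rpow_neg hl.le]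
    ring_nf
  have p4 : (2 : ℝ) ^ ((a + 1) * ((k + 1 : ℕ) : ℝ) / 2) = 2 ^ (a * k / 2) * 2 ^ ((a + 1) / 2) *
      2 ^ ((k : ℝ) / 2) := by
    rw [← Real.rpow_add two_pos, ← Real.rpow_add two_pos]
    push_cast
    ring_nf
  have p5 : (2 * Real.pi) ^ (-(k : ℝ) / 2) = (2 ^ ((k : ℝ) / 2) * Real.pi ^ ((k : ℝ) / 2))⁻¹ := by
    rw [← Real.mul_rpow two_pos.le Real.pi_pos.le, neg_div, Real.rpow_neg (by positivity)]
  have p6 : (m / 2) ^ ((a + 1) / 2) = m ^ ((a + 1) / 2) / 2 ^ ((a + 1) / 2) :=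
    Real.div_rpow hφ.le two_pos.le _
  rw [p1, p2, p3, p4, p5, p6]
  have := Real.pi_pos
  field_simp

/-- Bordering preserves the inverse Wishart normalization: given a positive definite block `A`,
the conditional density of a new row `(z, t)` integrates to one. -/
lemma lintegral_border {A F : Matrix ι ι ℝ} (hA : A.PosDef) (hF : F.PosDef) (f : ι → ℝ)
    (φ : ℝ) {a : ℝ} (ha : (Fintype.card ι : ℝ) - 1 < a) (hφ : 0 < φ - f ⬝ᵥ F⁻¹ *ᵥ f) :
    ∫⁻ z : ι → ℝ, ∫⁻ t : ℝ, (if 0 < t - z ⬝ᵥ A⁻¹ *ᵥ z then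
      ENNReal.ofReal (invWishartPDF (border F f φ) (a + 1) (border A z t) / invWishartPDF F a A)
      else 0) = 1 := by
  set s := (a + 1) / 2 with hs
  set m := φ - f ⬝ᵥ F⁻¹ *ᵥ f with hm
  set k : ℝ := (Fintype.card ι : ℝ) with hk
  have hk0 : 0 ≤ k := Nat.cast_nonneg _
  have hs0 : 0 < s := by rw [hs]; linarith
  have hG := Real.Gamma_pos_of_pos hs0
  have hdA := hA.det_pos
  have hdF := hF.det_pos
  -- the inverse gamma factor and the Gaussian factor, in the variables `(l, β)`
  let ig : ℝ → ENNReal := fun l => ENNReal.ofReal ((m / 2) ^ s / Real.Gamma s) *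
    ENNReal.ofReal (l ^ (-s - 1) * Real.exp (-(m / 2 / l)))
  let ga : ℝ → (ι → ℝ) → ENNReal := fun l β =>
    ENNReal.ofReal ((2 * Real.pi) ^ (-k / 2) * (l⁻¹ • F).det ^ (1 / 2 : ℝ)) *
    ENNReal.ofReal (Real.exp (-(1 / 2) * ((β - F⁻¹ *ᵥ f) ⬝ᵥ (l⁻¹ • F) *ᵥ (β - F⁻¹ *ᵥ f))))
  let H : ℝ → (ι → ℝ) → ENNReal := fun l β => if 0 < l then ig l * ga l β else 0
  have hHm : Measurable (fun p : (ι → ℝ) × ℝ => H p.2 p.1) := by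
    refine Measurable.ite (measurableSet_lt measurable_const measurable_snd) ?_ measurable_const
    simp only [ig, ga, Matrix.det_smul, Matrix.smul_mulVec, dotProduct_smul, smul_eq_mul]
    simp only [dotProduct, Matrix.mulVec, Pi.sub_apply]
    fun_prop
  have hga : ∀ l, 0 < l → ∫⁻ β, ga l β = 1 := by
    intro l hl
    have hP : (l⁻¹ • F).PosDef := hF.smul (inv_pos.2 hl)
    have hd := hP.det_pos
    simp only [ga]
    rw [lintegral_const_mul' _ _ ENNReal.ofReal_ne_top, lintegral_gaussian hP,
      ← ENNReal.ofReal_mul (by positivity), ← ENNReal.ofReal_one, neg_div,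
      Real.rpow_neg (by positivity), Real.rpow_neg hd.le]
    congr 1
    have : 0 < (2 * Real.pi) ^ (k / 2) := by positivity
    rw [← hk]
    field_simp
  have hig : ∫⁻ l in Set.Ioi (0 : ℝ), ig l = 1 := by
    simp only [ig]
    rw [lintegral_const_mul' _ _ ENNReal.ofReal_ne_top, lintegral_invGamma hs0 (half_pos hφ),
      ← ENNReal.ofReal_mul (by positivity), ← ENNReal.ofReal_one, Real.rpow_neg (by positivity)]
    congr 1
    have : 0 < (m / 2) ^ s := by positivity
    field_simp
  have hint : ∀ z : ι → ℝ, ∀ t : ℝ, (if 0 < t - z ⬝ᵥ A⁻¹ *ᵥ z then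
      ENNReal.ofReal (invWishartPDF (border F f φ) (a + 1) (border A z t) / invWishartPDF F a A)
      else 0) = ENNReal.ofReal A.det⁻¹ * H (t - z ⬝ᵥ A⁻¹ *ᵥ z) (A⁻¹ *ᵥ z) := by
    intro z t
    simp only [H]
    split_ifs with ht
    · have hd : 0 < (((t - z ⬝ᵥ A⁻¹ *ᵥ z)⁻¹ • F).det) := (hF.smul (inv_pos.2 ht)).det_pos
      rw [invWishartPDF_border hA hF f z φ t ha hφ ht, ENNReal.ofReal_mul (by positivity),
        ENNReal.ofReal_mul (by positivity), ENNReal.ofReal_mul (by positivity), ← mul_assoc _ _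
        (Real.exp (-(1 / 2) * _)), ENNReal.ofReal_mul (q := Real.exp (-(1 / 2) * _))
        (by positivity)]
    · rw [mul_zero]
  simp_rw [hint]
  have hHb : ∀ β, Measurable fun l => H l β := fun β =>
    hHm.comp (measurable_const.prodMk measurable_id)
  -- translate `t` to the Schur complement `l`, then pass from `z` to `β = A⁻¹ z`: the Jacobian
  -- `det A` cancels the factor `(det A)⁻¹`
  have h1 : ∀ z : ι → ℝ, ∫⁻ t : ℝ, ENNReal.ofReal A.det⁻¹ *
      H (t - z ⬝ᵥ A⁻¹ *ᵥ z) (A⁻¹ *ᵥ z) =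
      ENNReal.ofReal A.det⁻¹ * ∫⁻ l : ℝ, H l (A⁻¹ *ᵥ z) := by
    intro z
    rw [lintegral_const_mul' _ _ ENNReal.ofReal_ne_top,
      lintegral_sub_right_eq_self (fun l => H l (A⁻¹ *ᵥ z))]
  simp_rw [h1]
  rw [lintegral_const_mul' _ _ ENNReal.ofReal_ne_top,
    lintegral_comp_mulVec (M := A⁻¹) (f := fun β => ∫⁻ l, H l β) hA.inv.det_pos.ne'
      hHm.lintegral_prod_right', lintegral_lintegral_swap hHm.aemeasurable]
  have h2 : ∀ l, ∫⁻ β, H l β = (Set.Ioi (0 : ℝ)).indicator ig l := by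
    intro l
    by_cases hl : 0 < l
    · simp only [H, if_pos hl]
      rw [lintegral_const_mul' _ _ (ENNReal.mul_ne_top ENNReal.ofReal_ne_top
        ENNReal.ofReal_ne_top), hga l hl, mul_one, Set.indicator_of_mem (Set.mem_Ioi.2 hl)]
    · simp [H, hl]
  simp_rw [h2]
  rw [lintegral_indicator measurableSet_Ioi, hig, mul_one, ← ENNReal.ofReal_mul (by positivity),
    ← ENNReal.ofReal_one, Matrix.det_nonsing_inv, Ring.inverse_eq_inv', abs_of_pos (by positivity),
    inv_inv, inv_mul_cancel₀ hdA.ne']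

end Integrals

/-! ### Measurability of matrix functions -/

section Measurability

variable {α ι : Type*} [MeasurableSpace α] [Fintype ι] [DecidableEq ι]

lemma measurable_matrix_det {X : α → Matrix ι ι ℝ} (h : ∀ i j, Measurable fun y => X y i j) :
    Measurable fun y => (X y).det := by
  simp only [Matrix.det_apply]
  fun_prop

lemma measurable_matrix_inv {X : α → Matrix ι ι ℝ} (h : ∀ i j, Measurable fun y => X y i j)
    (i j : ι) : Measurable fun y => (X y)⁻¹ i j := by
  simp only [Matrix.inv_def, Ring.inverse_eq_inv', Matrix.smul_apply, Matrix.adjugate_apply,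
    smul_eq_mul]
  refine (measurable_matrix_det h).inv.mul (measurable_matrix_det fun k l => ?_)
  by_cases hk : k = j
  · simp [hk]
  · simpa [Matrix.updateRow_apply, hk] using h k l

lemma measurable_invWishartPDF (Φ : Matrix ι ι ℝ) (a : ℝ) {X : α → Matrix ι ι ℝ}
    (h : ∀ i j, Measurable fun y => X y i j) : Measurable fun y => invWishartPDF Φ a (X y) := by
  have h1 := measurable_matrix_det h
  have h2 := measurable_matrix_inv h
  have h3 : Measurable fun y => (Φ * (X y)⁻¹).trace := by
    simp only [Matrix.trace, Matrix.diag_apply, Matrix.mul_apply]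
    exact Finset.measurable_sum _ fun i _ => Finset.measurable_sum _ fun j _ => (h2 j i).const_mul _
  exact ((h1.pow_const _).const_mul _).mul (h3.const_mul _).exp

end Measurability

/-! ### Blocks with one node added -/

section Blocks

lemma invWishartPDF_submatrix_equiv {ι κ : Type*} [Fintype ι] [DecidableEq ι] [Fintype κ]
    [DecidableEq κ] (e : κ ≃ ι) (Φ Sig : Matrix ι ι ℝ) (a : ℝ) :
    invWishartPDF (Φ.submatrix e e) a (Sig.submatrix e e) = invWishartPDF Φ a Sig := by
  have : ((Φ * Sig⁻¹).submatrix e e).trace = (Φ * Sig⁻¹).trace := by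
    simp only [Matrix.trace, Matrix.diag_apply, Matrix.submatrix_apply]
    exact e.sum_comp fun i => (Φ * Sig⁻¹) i i
  rw [invWishartPDF, invWishartPDF, Matrix.det_submatrix_equiv_self,
    Matrix.det_submatrix_equiv_self, Fintype.card_congr e, Matrix.inv_submatrix_equiv,
    Matrix.submatrix_mul_equiv, this]

variable {V : Type*} [Fintype V] [DecidableEq V]

/-- The column `v` of `M`, restricted to the rows in `N`. -/
def colBlock (M : Matrix V V ℝ) (v : V) (N : Finset V) : N → ℝ := fun i => M i v

/-- The Schur complement of the block `N` in the block `N ∪ {v}`. For a covariance matrix it is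
the conditional variance of the variable `v` given the variables in `N`. -/
def condVar (M : Matrix V V ℝ) (v : V) (N : Finset V) : ℝ :=
  M v v - colBlock M v N ⬝ᵥ (block M N)⁻¹ *ᵥ colBlock M v N

/-- The nodes of `N ∪ {v}` as the nodes of `N` and one more. -/
def insertEquiv {v : V} {N : Finset V} (h : v ∉ N) : ↥(insert v N) ≃ N ⊕ Unit :=
  (Finset.subtypeInsertEquivOption h).trans (Equiv.optionEquivSumPUnit N)

omit [Fintype V] in
lemma insertEquiv_self {v : V} {N : Finset V} (h : v ∉ N) (hv : v ∈ insert v N) :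
    insertEquiv h ⟨v, hv⟩ = Sum.inr () := by
  simp [insertEquiv, Finset.subtypeInsertEquivOption]

omit [Fintype V] in
lemma insertEquiv_of_mem {v i : V} {N : Finset V} (h : v ∉ N) (hi : i ∈ N)
    (hi' : i ∈ insert v N) : insertEquiv h ⟨i, hi'⟩ = Sum.inl ⟨i, hi⟩ := by
  have : i ≠ v := by rintro rfl; exact h hi
  simp [insertEquiv, Finset.subtypeInsertEquivOption, this]

omit [Fintype V] in
lemma block_insert {M : Matrix V V ℝ} {v : V} {N : Finset V} (h : v ∉ N)
    (hs : ∀ i ∈ N, M v i = M i v) :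
    block M (insert v N) = (border (block M N) (colBlock M v N) (M v v)).submatrix
      (insertEquiv h) (insertEquiv h) := by
  ext ⟨i, hi⟩ ⟨j, hj⟩
  rcases Finset.mem_insert.1 hi with rfl | hi1 <;> rcases Finset.mem_insert.1 hj with rfl | hj1
  · simp [insertEquiv_self, border, block]
  · simp [insertEquiv_self, insertEquiv_of_mem h hj1, border, block, colBlock, hs j hj1]
  · simp [insertEquiv_self, insertEquiv_of_mem h hi1, border, block, colBlock]
  · simp [insertEquiv_of_mem h hi1, insertEquiv_of_mem h hj1, border, block]

omit [Fintype V] [DecidableEq V] in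
lemma block_posDef_mono {M : Matrix V V ℝ} {A B : Finset V} (hAB : A ⊆ B)
    (h : (block M B).PosDef) : (block M A).PosDef :=
  h.submatrix (e := fun i : A => (⟨i, hAB i.2⟩ : B)) fun i j hij =>
    Subtype.ext (by simpa using congrArg (fun b : B => (b : V)) hij)

omit [Fintype V] [DecidableEq V] in
lemma block_symm {M : Matrix V V ℝ} {A : Finset V} (h : (block M A).PosDef) {i j : V}
    (hi : i ∈ A) (hj : j ∈ A) : M i j = M j i := by
  simpa [block] using h.1.apply ⟨j, hj⟩ ⟨i, hi⟩

omit [Fintype V] in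
lemma block_insert_posDef_iff {M : Matrix V V ℝ} {v : V} {N : Finset V} (h : v ∉ N)
    (hs : ∀ i ∈ N, M v i = M i v) (hN : (block M N).PosDef) :
    (block M (insert v N)).PosDef ↔ 0 < condVar M v N := by
  rw [block_insert h hs, condVar, ← border_posDef_iff hN]
  constructor
  · intro h'
    simpa using h'.submatrix (insertEquiv h).symm.injective
  · intro h'
    exact h'.submatrix (insertEquiv h).injective

omit [Fintype V] in
lemma det_block_insert {M : Matrix V V ℝ} {v : V} {N : Finset V} (h : v ∉ N)
    (hs : ∀ i ∈ N, M v i = M i v) (hN : (block M N).PosDef) :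
    (block M (insert v N)).det = (block M N).det * condVar M v N := by
  rw [block_insert h hs, Matrix.det_submatrix_equiv_self, det_border hN, condVar]

omit [Fintype V] in
lemma condVar_pos {M : Matrix V V ℝ} {v : V} {N : Finset V} (h : v ∉ N)
    (hM : (block M (insert v N)).PosDef) : 0 < condVar M v N :=
  (block_insert_posDef_iff h (fun _ hi => block_symm hM (Finset.mem_insert_self _ _)
    (Finset.mem_insert_of_mem hi)) (block_posDef_mono (Finset.subset_insert _ _) hM)).1 hM

lemma margDof_insert (ϑ : ℝ) {v : V} {N : Finset V} (h : v ∉ N) :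
    margDof ϑ (insert v N) = margDof ϑ N + 1 := by
  rw [margDof, margDof, Finset.card_insert_of_notMem h]
  push_cast
  ring

omit [DecidableEq V] in
lemma card_sub_one_lt_margDof {ϑ : ℝ} (hϑ : (Fintype.card V : ℝ) - 1 < ϑ) (A : Finset V) :
    (Fintype.card A : ℝ) - 1 < margDof ϑ A := by
  rw [margDof, Fintype.card_coe]
  linarith

end Blocks

/-! ### Elimination sequences -/

section Elimination

variable {V : Type*} [DecidableEq V]

/-- The nodes of a sequence of pairs `(v, N)`. -/
def verts (l : List (V × Finset V)) : Finset V := (l.map Prod.fst).toFinset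

/-- The family `N ∪ {v}` of a pair `(v, N)`. -/
def fam (p : V × Finset V) : Finset V := insert p.1 p.2

/-- The set `N` is empty or contained in the family of a member of the sequence. -/
def Covered (l : List (V × Finset V)) (N : Finset V) : Prop := N = ∅ ∨ ∃ p ∈ l, N ⊆ fam p

/-- Perfect elimination sequences, last node first: every pair `(v, N)` adds to the nodes
further down the list a new node `v`, joined to the nodes of `N`, which are already joined to each
other. -/
inductive IsElim : List (V × Finset V) → Prop
  | nil : IsElim []
  | cons (v : V) (N : Finset V) (l : List (V × Finset V)) (hl : IsElim l) (hv : v ∉ verts l)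
      (hN : Covered l N) : IsElim ((v, N) :: l)

/-- The positions `vw` with `w ∈ N ∪ {v}`: those that the step `(v, N)` adds. -/
def newPairs (p : V × Finset V) : Finset (Sym2 V) := (fam p).image fun w => s(p.1, w)

/-- The positions `vv` and `vw`, with `w ∈ N`, of all the pairs `(v, N)` of the sequence. -/
def pairs : List (V × Finset V) → Finset (Sym2 V)
  | [] => ∅
  | p :: l => newPairs p ∪ pairs l

lemma verts_cons (p : V × Finset V) (l : List (V × Finset V)) :
    verts (p :: l) = insert p.1 (verts l) := by simp [verts]

lemma IsElim.fam_subset {l : List (V × Finset V)} (h : IsElim l) :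
    ∀ p ∈ l, fam p ⊆ verts l := by
  induction h with
  | nil => simp
  | cons v N l hl hv hN ih =>
    intro p hp
    rw [verts_cons]
    rcases List.mem_cons.1 hp with rfl | hp
    · refine Finset.insert_subset_insert _ ?_
      rcases hN with hN | ⟨q, hq, hN⟩
      · simp [show N = ∅ from hN]
      · exact hN.trans (ih q hq)
    · exact (ih p hp).trans (Finset.subset_insert _ _)

lemma Covered.subset_verts {l : List (V × Finset V)} {N : Finset V} (h : Covered l N)
    (hl : IsElim l) : N ⊆ verts l := by
  rcases h with rfl | ⟨p, hp, h⟩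
  · simp
  · exact h.trans (hl.fam_subset p hp)

lemma IsElim.sym2_fam_subset {l : List (V × Finset V)} (h : IsElim l) :
    ∀ p ∈ l, (fam p).sym2 ⊆ pairs l := by
  induction h with
  | nil => simp
  | cons v N l hl hv hN ih =>
    intro p hp
    rw [pairs]
    rcases List.mem_cons.1 hp with rfl | hp
    · intro e
      induction e with | _ a b
      rw [Finset.mk_mem_sym2_iff, fam, Finset.mem_insert, Finset.mem_insert]
      rintro ⟨rfl | ha, rfl | hb⟩
      · exact Finset.mem_union_left _ (Finset.mem_image_of_mem _ (by simp [fam]))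
      · exact Finset.mem_union_left _ (Finset.mem_image_of_mem _ (by simp [fam, hb]))
      · rw [Sym2.eq_swap]
        exact Finset.mem_union_left _ (Finset.mem_image_of_mem _ (by simp [fam, ha]))
      · refine Finset.mem_union_right _ ?_
        rcases hN with hN | ⟨q, hq, hN⟩
        · simp [show N = ∅ from hN] at ha
        · exact ih q hq (Finset.mk_mem_sym2_iff.2 ⟨hN ha, hN hb⟩)
    · exact (ih p hp).trans Finset.subset_union_right

lemma IsElim.pairs_subset {l : List (V × Finset V)} (h : IsElim l) :
    pairs l ⊆ (verts l).sym2 := by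
  induction h with
  | nil => simp [pairs]
  | cons v N l hl hv hN ih =>
    rw [pairs, verts_cons]
    refine Finset.union_subset (fun e he => ?_)
      (ih.trans (Finset.sym2_mono (Finset.subset_insert _ _)))
    obtain ⟨w, hw, rfl⟩ := Finset.mem_image.1 he
    refine Finset.mk_mem_sym2_iff.2 ⟨Finset.mem_insert_self _ _, ?_⟩
    rcases Finset.mem_insert.1 hw with rfl | hw
    · exact Finset.mem_insert_self _ _
    · exact Finset.mem_insert_of_mem (hN.subset_verts hl hw)

/-- The product `∏ F (N ∪ {v}) / F N` over the pairs `(v, N)` of the sequence. -/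
def elimRatio (F : Finset V → ℝ) (l : List (V × Finset V)) : ℝ :=
  (l.map fun p => F (fam p) / F p.2).prod

lemma elimRatio_cons (F : Finset V → ℝ) (p : V × Finset V) (l : List (V × Finset V)) :
    elimRatio F (p :: l) = F (fam p) / F p.2 * elimRatio F l := by simp [elimRatio]

end Elimination

/-! ### Integrating out one row at a time -/

section StepDensity

variable {V : Type*}

/-- The symmetric matrix with entry `y s(i, j)` at `(i, j)`. -/
def symMat (y : Sym2 V → ℝ) : Matrix V V ℝ := Matrix.of fun i j => y s(i, j)

lemma symMat_comm (y : Sym2 V → ℝ) (i j : V) : symMat y i j = symMat y j i := by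
  simp [symMat, Sym2.eq_swap]

variable [Fintype V] [DecidableEq V]

open Classical in
/-- The conditional density of the row `v` of an inverse Wishart matrix given its block `N`, as a
ratio of inverse Wishart densities and a function of all the entries; it is set to zero unless the
Schur complement of `N` is positive. Only where the block `N` is positive definite does that
condition amount to positive definiteness of the block `N ∪ {v}`. -/
def stepDensity (Φ : Matrix V V ℝ) (ϑ : ℝ) (p : V × Finset V) (y : Sym2 V → ℝ) : ENNReal :=
  if 0 < condVar (symMat y) p.1 p.2 then
    ENNReal.ofReal (invWishartPDF (block Φ (fam p)) (margDof ϑ (fam p)) (block (symMat y) (fam p)) /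
      invWishartPDF (block Φ p.2) (margDof ϑ p.2) (block (symMat y) p.2))
  else 0

omit [Fintype V] [DecidableEq V] in
lemma block_symMat_congr {y y' : Sym2 V → ℝ} {A : Finset V} (h : ∀ e ∈ A.sym2, y e = y' e) :
    block (symMat y) A = block (symMat y') A := by
  ext ⟨i, hi⟩ ⟨j, hj⟩
  exact h _ (Finset.mk_mem_sym2_iff.2 ⟨hi, hj⟩)

omit [Fintype V] in
lemma condVar_symMat_congr {y y' : Sym2 V → ℝ} {v : V} {N : Finset V}
    (h : ∀ e ∈ (insert v N).sym2, y e = y' e) :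
    condVar (symMat y) v N = condVar (symMat y') v N := by
  have h1 : colBlock (symMat y) v N = colBlock (symMat y') v N := by
    ext ⟨i, hi⟩
    exact h _ (Finset.mk_mem_sym2_iff.2 ⟨Finset.mem_insert_of_mem hi, Finset.mem_insert_self _ _⟩)
  have h2 : symMat y v v = symMat y' v v :=
    h _ (Finset.mk_mem_sym2_iff.2 ⟨Finset.mem_insert_self _ _, Finset.mem_insert_self _ _⟩)
  rw [condVar, condVar, h1, h2,
    block_symMat_congr fun e he => h e (Finset.sym2_mono (Finset.subset_insert _ _) he)]

lemma stepDensity_congr (Φ : Matrix V V ℝ) (ϑ : ℝ) (p : V × Finset V) {y y' : Sym2 V → ℝ}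
    (h : ∀ e ∈ (fam p).sym2, y e = y' e) : stepDensity Φ ϑ p y = stepDensity Φ ϑ p y' := by
  rw [stepDensity, stepDensity, condVar_symMat_congr (v := p.1) (N := p.2) h,
    block_symMat_congr h, block_symMat_congr fun e he =>
      h e (Finset.sym2_mono (Finset.subset_insert _ _) he)]

omit [Fintype V] [DecidableEq V] in
lemma measurable_symMat (i j : V) : Measurable fun y : Sym2 V → ℝ => symMat y i j :=
  measurable_pi_apply _

omit [Fintype V] in
lemma measurable_condVar (v : V) (N : Finset V) :
    Measurable fun y : Sym2 V → ℝ => condVar (symMat y) v N := by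
  have h := measurable_matrix_inv (X := fun y : Sym2 V → ℝ => block (symMat y) N)
    fun i j => measurable_symMat i.1 j.1
  simp only [condVar, dotProduct, Matrix.mulVec, colBlock]
  refine (measurable_symMat v v).sub (Finset.measurable_sum _ fun i _ =>
    (measurable_symMat _ _).mul (Finset.measurable_sum _ fun j _ =>
      (h i j).mul (measurable_symMat _ _)))

lemma measurable_stepDensity (Φ : Matrix V V ℝ) (ϑ : ℝ) (p : V × Finset V) :
    Measurable (stepDensity Φ ϑ p) := by
  have h (A : Finset V) := measurable_invWishartPDF (block Φ A) (margDof ϑ A)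
    (X := fun y : Sym2 V → ℝ => block (symMat y) A) fun i j => measurable_symMat i.1 j.1
  exact Measurable.ite (measurableSet_lt measurable_const (measurable_condVar _ _))
    ((h (fam p)).div (h p.2)).ennreal_ofReal measurable_const

/-- For a fixed positive definite block `N`, the conditional density of the row `v` integrates to
one over the entries of that row. -/
lemma lmarginal_stepDensity {Φ : Matrix V V ℝ} {ϑ : ℝ} (hϑ : (Fintype.card V : ℝ) - 1 < ϑ)
    {v : V} {N : Finset V} (hv : v ∉ N) (hΦ : (block Φ (insert v N)).PosDef) (y : Sym2 V → ℝ)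
    (hy : (block (symMat y) N).PosDef) :
    (∫⋯∫⁻_newPairs (v, N), stepDensity Φ ϑ (v, N)) y = 1 := by
  have hg : Function.Injective fun w : V => s(v, w) := fun a b h => Sym2.congr_right.1 h
  have hnot : s(v, v) ∉ N.image fun w => s(v, w) := by
    simp only [Finset.mem_image, not_exists, not_and]
    intro w hw h
    exact hv ((hg h : w = v) ▸ hw)
  rw [newPairs, fam, Finset.image_insert, lmarginal_insert' _ (measurable_stepDensity Φ ϑ _) hnot,
    lmarginal]
  let e : N ≃ ↥(N.image fun w => s(v, w)) :=
    (Equiv.ofBijective (fun w : N => (⟨s(v, w), Finset.mem_image_of_mem _ w.2⟩ :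
      ↥(N.image fun w => s(v, w)))) ⟨fun a b h => Subtype.ext (hg (congrArg Subtype.val h)),
      fun ⟨x, hx⟩ => by
        obtain ⟨w, hw, rfl⟩ := Finset.mem_image.1 hx
        exact ⟨⟨w, hw⟩, rfl⟩⟩)
  have hmp := volume_measurePreserving_piCongrLeft (fun _ : ↥(N.image fun w => s(v, w)) => ℝ) e
  rw [← volume_pi, ← hmp.lintegral_comp_emb (MeasurableEquiv.measurableEmbedding _)]
  rw [← lintegral_border hy (block_posDef_mono (Finset.subset_insert v N) hΦ) (colBlock Φ v N)
    (Φ v v) (card_sub_one_lt_margDof hϑ N) (condVar_pos hv hΦ)]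
  refine lintegral_congr fun z => lintegral_congr fun t => ?_
  -- the matrix with the entries of the row `v` replaced by `(z, t)`
  set y' := Function.update (Function.updateFinset y (N.image fun w => s(v, w))
    (MeasurableEquiv.piCongrLeft (fun _ => ℝ) e z)) s(v, v) t with hy'
  have e1 : block (symMat y') N = block (symMat y) N := by
    refine block_symMat_congr fun x hx => ?_
    have h1 : x ≠ s(v, v) := by
      rintro rfl
      exact hv (Finset.mk_mem_sym2_iff.1 hx).1
    have h2 : x ∉ N.image fun w => s(v, w) := by
      rintro h
      obtain ⟨w, hw, rfl⟩ := Finset.mem_image.1 h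
      exact hv (Finset.mk_mem_sym2_iff.1 hx).1
    rw [hy', Function.update_of_ne h1, Function.updateFinset, dif_neg h2]
  have e2 : colBlock (symMat y') v N = z := by
    ext ⟨i, hi⟩
    have h1 : s(v, i) ≠ s(v, v) := fun h => hv ((hg h : i = v) ▸ hi)
    have h2 : s(v, i) ∈ N.image fun w => s(v, w) := Finset.mem_image_of_mem _ hi
    rw [colBlock, symMat_comm]
    simp only [symMat, Matrix.of_apply]
    rw [hy', Function.update_of_ne h1, Function.updateFinset, dif_pos h2]
    exact Equiv.piCongrLeft_apply_apply (fun _ => ℝ) e z ⟨i, hi⟩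
  have e3 : symMat y' v v = t := by simp [symMat, hy']
  have e4 : condVar (symMat y') v N = t - z ⬝ᵥ (block (symMat y) N)⁻¹ *ᵥ z := by
    rw [condVar, e1, e2, e3]
  rw [stepDensity, e4, fam, block_insert hv (fun i _ => symMat_comm y' v i),
    block_insert hv (fun i hi => block_symm hΦ (Finset.mem_insert_self _ _)
      (Finset.mem_insert_of_mem hi)), invWishartPDF_submatrix_equiv, e1, e2, e3,
    margDof_insert ϑ hv]

/-- The product of the conditional densities of the steps of a sequence. -/
def elimDensity (Φ : Matrix V V ℝ) (ϑ : ℝ) (l : List (V × Finset V)) (y : Sym2 V → ℝ) : ENNReal :=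
  (l.map fun p => stepDensity Φ ϑ p y).prod

lemma measurable_elimDensity (Φ : Matrix V V ℝ) (ϑ : ℝ) (l : List (V × Finset V)) :
    Measurable (elimDensity Φ ϑ l) := by
  induction l with
  | nil => exact measurable_const
  | cons p l ih =>
    have : elimDensity Φ ϑ (p :: l) = fun y => stepDensity Φ ϑ p y * elimDensity Φ ϑ l y := by
      ext y; simp [elimDensity]
    rw [this]
    exact (measurable_stepDensity Φ ϑ p).mul ih

omit [Fintype V] [DecidableEq V] in
lemma block_empty_posDef (M : Matrix V V ℝ) : (block M ∅).PosDef := by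
  rw [block]
  refine ⟨Subsingleton.elim _ _, fun x hx => (hx (Subsingleton.elim _ _)).elim⟩

omit [Fintype V] in
lemma Covered.block_posDef {M : Matrix V V ℝ} {l : List (V × Finset V)} {N : Finset V}
    (h : Covered l N) (hM : ∀ p ∈ l, (block M (fam p)).PosDef) : (block M N).PosDef := by
  rcases h with rfl | ⟨p, hp, h⟩
  · exact block_empty_posDef M
  · exact block_posDef_mono h (hM p hp)

omit [Fintype V] in
lemma IsElim.posDef_of_condVar_pos {M : Matrix V V ℝ} (hM : ∀ i j, M i j = M j i)
    {l : List (V × Finset V)} (hl : IsElim l) (h : ∀ p ∈ l, 0 < condVar M p.1 p.2) :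
    ∀ p ∈ l, (block M (fam p)).PosDef := by
  induction hl with
  | nil => simp
  | cons v N l hl hv hN ih =>
    have h' := ih fun p hp => h p (List.mem_cons_of_mem _ hp)
    intro p hp
    rcases List.mem_cons.1 hp with rfl | hp
    · exact (block_insert_posDef_iff (fun hvN => hv (hN.subset_verts hl hvN)) (fun i _ => hM v i)
        (hN.block_posDef h')).2 (h _ List.mem_cons_self)
    · exact h' p hp

lemma condVar_pos_of_elimDensity_ne_zero {Φ : Matrix V V ℝ} {ϑ : ℝ} {l : List (V × Finset V)}
    {y : Sym2 V → ℝ} (h : elimDensity Φ ϑ l y ≠ 0) : ∀ p ∈ l, 0 < condVar (symMat y) p.1 p.2 := by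
  intro p hp
  by_contra hc
  refine h (List.prod_eq_zero (List.mem_map.2 ⟨p, hp, ?_⟩))
  rw [stepDensity, if_neg hc]

/-- The product of the conditional densities integrates to one: integrate out the rows in the
order of the elimination sequence. -/
lemma IsElim.lmarginal_elimDensity {Φ : Matrix V V ℝ} {ϑ : ℝ}
    (hϑ : (Fintype.card V : ℝ) - 1 < ϑ) {l : List (V × Finset V)} (hl : IsElim l)
    (hΦ : ∀ p ∈ l, (block Φ (fam p)).PosDef) :
    (∫⋯∫⁻_pairs l, elimDensity Φ ϑ l) = 1 := by
  induction hl with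
  | nil =>
    rw [pairs, lmarginal_empty]
    rfl
  | cons v N l hl hv hN ih =>
    have hvN : v ∉ N := fun hvN => hv (hN.subset_verts hl hvN)
    have hdis : ∀ e ∈ pairs l, e ∉ newPairs (v, N) := by
      intro e he he'
      obtain ⟨w, hw, rfl⟩ := Finset.mem_image.1 he'
      exact hv (Finset.mk_mem_sym2_iff.1 (hl.pairs_subset he)).1
    rw [pairs, Finset.union_comm, lmarginal_union _ _ (measurable_elimDensity Φ ϑ _)
      (Finset.disjoint_left.2 hdis)]
    refine Eq.trans ?_ (ih fun p hp => hΦ p (List.mem_cons_of_mem _ hp))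
    congr 1
    ext y
    have h1 : ∀ z, elimDensity Φ ϑ ((v, N) :: l) (Function.updateFinset y (newPairs (v, N)) z) =
        elimDensity Φ ϑ l y *
          stepDensity Φ ϑ (v, N) (Function.updateFinset y (newPairs (v, N)) z) := by
      intro z
      rw [elimDensity, List.map_cons, List.prod_cons, mul_comm]
      congr 1
      rw [elimDensity]
      congr 1
      refine List.map_congr_left fun p hp => stepDensity_congr Φ ϑ p fun e he => ?_
      rw [Function.updateFinset, dif_neg (hdis e (hl.sym2_fam_subset p hp he))]
    rw [lmarginal]
    simp_rw [h1]
    -- where the earlier factors vanish, the block `N` need not be positive definite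
    by_cases h0 : elimDensity Φ ϑ l y = 0
    · simp [h0]
    · have hm : Measurable fun z => stepDensity Φ ϑ (v, N)
          (Function.updateFinset y (newPairs (v, N)) z) :=
        (measurable_stepDensity Φ ϑ _).comp measurable_updateFinset
      rw [lintegral_const_mul _ hm]
      have hy := hl.posDef_of_condVar_pos (symMat_comm y) (condVar_pos_of_elimDensity_ne_zero h0)
      have := lmarginal_stepDensity hϑ hvN (hΦ _ List.mem_cons_self) y (hN.block_posDef hy)
      rw [lmarginal] at this
      rw [this, mul_one]

end StepDensity

/-! ### Elimination sequences of junction trees -/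

section JunctionTree

variable {V : Type*} [DecidableEq V]

/-- An elimination sequence can be extended by the nodes of `R`, all joined to each other and to
the nodes of a covered set `N`; the ratio is multiplied by `F (N ∪ R) / F N`. -/
lemma IsElim.exists_extend {l : List (V × Finset V)} (hl : IsElim l) {N : Finset V}
    (hN : Covered l N) (R : Finset V) (hR : Disjoint R (verts l)) :
    ∃ l', IsElim l' ∧ verts l' = R ∪ verts l ∧ pairs l' = (R ∪ N).sym2 ∪ pairs l ∧
      Covered l' (R ∪ N) ∧ (∀ p ∈ l, p ∈ l') ∧ (∀ p ∈ l', p ∈ l ∨ fam p ⊆ R ∪ N) ∧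
      ∀ F : Finset V → ℝ, (∀ A, A ⊆ R ∪ N → F A ≠ 0) →
        elimRatio F l' = F (R ∪ N) / F N * elimRatio F l := by
  induction R using Finset.induction_on with
  | empty =>
    refine ⟨l, hl, by simp, ?_, by simpa using hN, fun p hp => hp, fun p hp => .inl hp,
      fun F hF => by simp [hF N (by simp)]⟩
    rw [Finset.empty_union, eq_comm, Finset.union_eq_right]
    rcases hN with rfl | ⟨p, hp, h⟩
    · simp
    · exact (Finset.sym2_mono h).trans (hl.sym2_fam_subset p hp)
  | insert v R hvR ih =>
    rw [Finset.disjoint_insert_left] at hR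
    obtain ⟨l', h1, h2, h3, h4, h5, h6, h7⟩ := ih hR.2
    have hv : v ∉ verts l' := by
      rw [h2, Finset.mem_union, not_or]
      exact ⟨hvR, hR.1⟩
    have hf : fam (v, R ∪ N) = insert v R ∪ N := (Finset.insert_union _ _ _).symm
    refine ⟨(v, R ∪ N) :: l', .cons v _ l' h1 hv h4, ?_, ?_, ?_, ?_, ?_, ?_⟩
    · rw [verts_cons, h2, Finset.insert_union]
    · rw [pairs, h3, ← Finset.union_assoc]
      congr 1
      rw [newPairs, hf]
      ext e
      induction e with | _ a b
      simp only [Finset.mem_union, Finset.mem_image, Finset.mk_mem_sym2_iff, Finset.mem_insert,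
        Sym2.eq_iff]
      grind
    · exact .inr ⟨_, List.mem_cons_self, hf.ge⟩
    · exact fun p hp => List.mem_cons_of_mem _ (h5 p hp)
    · intro p hp
      rcases List.mem_cons.1 hp with rfl | hp
      · exact .inr hf.le
      · refine (h6 p hp).imp_right fun h => h.trans ?_
        rw [Finset.insert_union]
        exact Finset.subset_insert _ _
    · intro F hF
      have hsub : R ∪ N ⊆ insert v R ∪ N := by
        rw [Finset.insert_union]
        exact Finset.subset_insert _ _
      have := hF (R ∪ N) hsub
      rw [elimRatio_cons, h7 F fun A hA => hF A (hA.trans hsub), hf]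
      field_simp

variable [Fintype V] {G : SimpleGraph V}

/-- The nodes of a connected set of cliques of a junction tree have an elimination sequence, in
which the ratio is the one of the cliques in the set and the separators between them. The set grows
from one clique by adding, each time, a clique `Q` joined in the tree to a clique `P` of the set:
the running intersection property says that the nodes of `Q` already present are those in `P`. -/
lemma IsJunctionTree.exists_isElim_aux {T : SimpleGraph (Cliques G)} (hT : IsJunctionTree G T)
    (k : ℕ) (hk : 1 ≤ k) (hk' : k ≤ Nat.card (Cliques G)) :
    ∃ (C : Finset (Cliques G)) (E : Finset (Sym2 (Cliques G))) (l : List (V × Finset V)),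
      C.card = k ∧ E.card + 1 = k ∧ (E : Set (Sym2 (Cliques G))) ⊆ T.edgeSet ∧
      (∀ e ∈ E, ∀ Q ∈ e, Q ∈ C) ∧
      (∀ P ∈ C, ∀ Q ∈ C, ∃ w : T.Walk P Q, w.IsPath ∧ ∀ R ∈ w.support, R ∈ C) ∧
      IsElim l ∧ (∀ v, v ∈ verts l ↔ ∃ Q ∈ C, v ∈ Q.1) ∧
      (∀ e, e ∈ pairs l ↔ ∃ Q ∈ C, e ∈ Q.1.sym2) ∧
      (∀ Q ∈ C, Covered l Q.1) ∧ (∀ p ∈ l, ∃ Q ∈ C, fam p ⊆ Q.1) ∧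
      ∀ F : Finset V → ℝ, (∀ Q : Cliques G, ∀ A, A ⊆ Q.1 → F A ≠ 0) → F ∅ = 1 →
        elimRatio F l = (∏ Q ∈ C, F Q.1) / ∏ e ∈ E, F (sep e) := by
  classical
  induction k, hk using Nat.le_induction with
  | base =>
    obtain ⟨r⟩ := hT.isTree.connected.nonempty
    obtain ⟨l, h1, h2, h3, h4, h5, h6, h7⟩ :=
      IsElim.nil.exists_extend (N := ∅) (.inl rfl) r.1 (by simp [verts])
    refine ⟨{r}, ∅, l, by simp, by simp, by simp, by simp, ?_, h1, ?_, ?_, ?_, ?_, ?_⟩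
    · intro P hP Q hQ
      rw [Finset.mem_singleton] at hP hQ
      subst hP hQ
      exact ⟨.nil, by simp, by simp⟩
    · intro v
      rw [h2]
      simp [verts]
    · simp [h3, pairs]
    · simpa using h4
    · intro p hp
      simpa using h6 p hp
    · intro F hF hF0
      rw [h7 F fun A hA => hF r A (by simpa using hA)]
      simp [hF0, elimRatio]
  | succ k hk ih =>
    obtain ⟨C, E, l, hC, hE, hET, hEC, hpath, hl, hverts, hpairs, hcov, hfam, hratio⟩ :=
      ih (by omega)
    obtain ⟨r, hr⟩ : C.Nonempty := Finset.card_pos.1 (by omega)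
    obtain ⟨q, hq⟩ : ∃ q, q ∉ C := by
      by_contra! h
      have : C = Finset.univ := Finset.eq_univ_iff_forall.2 h
      rw [this, Finset.card_univ, ← Nat.card_eq_fintype_card] at hC
      omega
    obtain ⟨w⟩ := hT.isTree.connected r q
    obtain ⟨⟨⟨P, Q⟩, hPQ⟩, -, hP, hQ⟩ := w.exists_boundary_dart (C : Set (Cliques G)) hr hq
    simp only [Finset.mem_coe] at hP hQ hPQ
    -- the path from `Q` to any clique of `C` starts with the edge `QP`
    have hpathQ : ∀ R ∈ C, ∃ w : T.Walk R Q, w.IsPath ∧ (∀ S ∈ w.support, S ∈ insert Q C) ∧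
        P ∈ w.support := by
      intro R hR
      obtain ⟨w, hw, hwC⟩ := hpath R hR P hP
      refine ⟨w.concat hPQ, hw.concat (fun h => hQ (hwC Q h)) hPQ, ?_, ?_⟩
      · intro S hS
        rw [SimpleGraph.Walk.support_concat, List.mem_append, List.mem_singleton] at hS
        rcases hS with hS | rfl
        · exact Finset.mem_insert_of_mem (hwC S hS)
        · exact Finset.mem_insert_self _ _
      · rw [SimpleGraph.Walk.support_concat]
        exact List.mem_append_left _ w.end_mem_support
    have hrun : ∀ v ∈ Q.1, v ∈ verts l → v ∈ P.1 := by
      intro v hvQ hv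
      obtain ⟨R, hR, hvR⟩ := (hverts v).1 hv
      obtain ⟨w, hw, -, hPw⟩ := hpathQ R hR
      exact hT.inter_subset R Q w hw P hPw (Finset.mem_inter.2 ⟨hvR, hvQ⟩)
    have hsep : Covered l (P.1 ∩ Q.1) := by
      refine (hcov P hP).imp (fun h => by simp [h]) ?_
      rintro ⟨p, hp, h⟩
      exact ⟨p, hp, Finset.inter_subset_left.trans h⟩
    obtain ⟨l', h1, h2, h3, h4, h5, h6, h7⟩ := hl.exists_extend hsep (Q.1 \ verts l)
      Finset.sdiff_disjoint
    have hQ1 : Q.1 \ verts l ∪ P.1 ∩ Q.1 = Q.1 := by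
      ext v
      simp only [Finset.mem_union, Finset.mem_sdiff, Finset.mem_inter]
      have := hrun v
      tauto
    rw [hQ1] at h3 h4 h6 h7
    have hnew : s(P, Q) ∉ E := fun h => hQ (hEC _ h Q (Sym2.mem_mk_right _ _))
    refine ⟨insert Q C, insert s(P, Q) E, l', ?_, ?_, ?_, ?_, ?_, h1, ?_, ?_, ?_, ?_, ?_⟩
    · rw [Finset.card_insert_of_notMem hQ, hC]
    · rw [Finset.card_insert_of_notMem hnew, hE]
    · rw [Finset.coe_insert, Set.insert_subset_iff]
      exact ⟨hPQ, hET⟩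
    · intro e he R hR
      rcases Finset.mem_insert.1 he with rfl | he
      · rcases Sym2.mem_iff.1 hR with rfl | rfl
        · exact Finset.mem_insert_of_mem hP
        · exact Finset.mem_insert_self _ _
      · exact Finset.mem_insert_of_mem (hEC e he R hR)
    · intro R hR S hS
      rcases Finset.mem_insert.1 hR with rfl | hR' <;>
        rcases Finset.mem_insert.1 hS with rfl | hS'
      · exact ⟨.nil, by simp, by simp⟩
      · obtain ⟨w, hw, hwC, -⟩ := hpathQ S hS'
        exact ⟨w.reverse, hw.reverse, by simpa using hwC⟩
      · obtain ⟨w, hw, hwC, -⟩ := hpathQ R hR'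
        exact ⟨w, hw, hwC⟩
      · obtain ⟨w, hw, hwC⟩ := hpath R hR' S hS'
        exact ⟨w, hw, fun X hX => Finset.mem_insert_of_mem (hwC X hX)⟩
    · intro v
      rw [h2, Finset.mem_union, Finset.mem_sdiff, Finset.exists_mem_insert, ← hverts]
      tauto
    · intro e
      rw [h3, Finset.mem_union, Finset.exists_mem_insert, ← hpairs]
    · intro R hR
      rcases Finset.mem_insert.1 hR with rfl | hR
      · exact h4
      · refine (hcov R hR).imp_right ?_
        rintro ⟨p, hp, h⟩
        exact ⟨p, h5 p hp, h⟩
    · intro p hp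
      rcases h6 p hp with hp | hp
      · obtain ⟨R, hR, h⟩ := hfam p hp
        exact ⟨R, Finset.mem_insert_of_mem hR, h⟩
      · exact ⟨Q, Finset.mem_insert_self _ _, hp⟩
    · intro F hF hF0
      rw [h7 F (hF Q), hratio F hF hF0, Finset.prod_insert hQ, Finset.prod_insert hnew]
      have : sep s(P, Q) = P.1 ∩ Q.1 := rfl
      rw [this, div_mul_div_comm]

omit [DecidableEq V] in
lemma exists_clique_superset {U : Finset V} (hU : G.IsClique (U : Set V)) :
    ∃ Q : Cliques G, U ⊆ Q.1 := by
  obtain ⟨Q, hUQ, hQ⟩ := (Set.toFinite {U : Finset V | G.IsClique (U : Set V)}).exists_le_maximal hU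
  exact ⟨⟨Q, hQ⟩, hUQ⟩

/-- A graph with a junction tree has an elimination sequence of all its nodes, in which the
clique/separator ratios telescope. -/
lemma IsJunctionTree.exists_isElim {T : SimpleGraph (Cliques G)} (hT : IsJunctionTree G T) :
    ∃ l : List (V × Finset V), IsElim l ∧ verts l = Finset.univ ∧
      (∀ e, e ∈ pairs l ↔ (e.IsDiag ∨ e ∈ G.edgeSet)) ∧ (∀ p ∈ l, ∃ Q : Cliques G, fam p ⊆ Q.1) ∧
      ∀ F : Finset V → ℝ, (∀ Q : Cliques G, ∀ A, A ⊆ Q.1 → F A ≠ 0) → F ∅ = 1 →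
        cliqueSepRatio T F = elimRatio F l := by
  classical
  have := hT.isTree.connected.nonempty
  obtain ⟨C, E, l, hC, hE, hET, -, -, hl, hverts, hpairs, -, hfam, hratio⟩ :=
    hT.exists_isElim_aux _ Nat.card_pos le_rfl
  have hC' : C = Finset.univ := by
    rw [← Finset.card_eq_iff_eq_univ, hC, Nat.card_eq_fintype_card]
  -- a tree has one edge fewer than nodes, so `E` exhausts the edges
  have hE' : E = T.edgeFinset := by
    refine Finset.eq_of_subset_of_card_le (fun e he => ?_) ?_
    · rw [SimpleGraph.mem_edgeFinset]
      exact hET he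
    · have := hT.isTree.card_edgeFinset
      rw [Nat.card_eq_fintype_card] at hE
      omega
  subst hC' hE'
  refine ⟨l, hl, ?_, ?_, fun p hp => (hfam p hp).imp fun Q h => h.2, ?_⟩
  · refine Finset.eq_univ_iff_forall.2 fun v => (hverts v).2 ?_
    obtain ⟨Q, hQ⟩ := exists_clique_superset (G := G) (U := {v}) (by simp)
    exact ⟨Q, Finset.mem_univ _, hQ (Finset.mem_singleton_self v)⟩
  · intro e
    rw [hpairs]
    induction e with | _ a b
    simp only [Finset.mk_mem_sym2_iff, Sym2.mk_isDiag_iff, SimpleGraph.mem_edgeSet]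
    constructor
    · rintro ⟨Q, -, ha, hb⟩
      exact or_iff_not_imp_left.2 fun h => Q.2.1 ha hb h
    · intro h
      obtain ⟨Q, hQ⟩ := exists_clique_superset (G := G) (U := {a, b}) (by
        rcases h with rfl | h
        · simp
        · simpa [SimpleGraph.isClique_pair] using fun _ => h)
      exact ⟨Q, Finset.mem_univ _, hQ (by simp), hQ (by simp)⟩
  · intro F hF hF0
    rw [hratio F hF hF0, cliqueSepRatio]

end JunctionTree

/-! ### Positive definite completion -/

section Completion

variable {V : Type*} [Fintype V] [DecidableEq V]

/-- In a vector `X` with covariance matrix `S`, let the component `v` have variance one and be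
uncorrelated with the others. Replacing it by `∑ βᵢ Xᵢ` plus an uncorrelated error of variance `c`
gives the covariance matrix `S'`. -/
lemma exists_posDef_replace {S : Matrix V V ℝ} (hS : S.PosDef) {v : V}
    (hv : S *ᵥ Pi.single v 1 = Pi.single v 1) {β : V → ℝ} (hβ : β v = 0) {c : ℝ} (hc : 0 < c) :
    ∃ S' : Matrix V V ℝ, S'.PosDef ∧ (∀ i j, i ≠ v → j ≠ v → S' i j = S i j) ∧
      (∀ j, j ≠ v → S' v j = (S *ᵥ β) j) ∧ S' v v = β ⬝ᵥ S *ᵥ β + c ∧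
      S'⁻¹ = S⁻¹ - Matrix.vecMulVec (Pi.single v 1) (Pi.single v 1) +
        c⁻¹ • Matrix.vecMulVec (Pi.single v 1 - β) (Pi.single v 1 - β) ∧
      S'.det = c * S.det := by
  set e : V → ℝ := Pi.single v 1 with he
  have hee : e ⬝ᵥ e = 1 := by simp [he]
  have hs := isHermitian_real_iff.1 hS.1
  have hu := (Matrix.isUnit_iff_isUnit_det S).1 hS.isUnit
  have hv' : e ᵥ* S = e := by rw [← Matrix.mulVec_transpose, hs, hv]
  have hKv : S⁻¹ *ᵥ e = e := by
    conv_lhs => rw [← hv]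
    rw [Matrix.mulVec_mulVec, Matrix.nonsing_inv_mul _ hu, Matrix.one_mulVec]
  have hKv' : e ᵥ* S⁻¹ = e := by
    rw [← Matrix.mulVec_transpose, Matrix.transpose_nonsing_inv, hs, hKv]
  set r := Real.sqrt c with hr
  have hr0 : 0 < r := Real.sqrt_pos.2 hc
  have hrc : r * r = c := Real.mul_self_sqrt hc.le
  -- `M = 1 + e a'` has inverse `1 + e d'`
  set a : V → ℝ := β + (r - 1) • e with ha
  set d : V → ℝ := r⁻¹ • (e - β) - e with hd
  set M : Matrix V V ℝ := 1 + Matrix.vecMulVec e a with hM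
  have hMdet : M.det = r := by
    rw [hM, Matrix.vecMulVec_eq Unit, Matrix.det_one_add_replicateCol_mul_replicateRow, ha,
      add_dotProduct, smul_dotProduct, hee]
    simp [he, hβ]
  have hae : a ⬝ᵥ e = r - 1 := by
    rw [ha, add_dotProduct, smul_dotProduct, hee]
    simp [he, hβ]
  have hMinv : M⁻¹ = 1 + Matrix.vecMulVec e d := by
    apply Matrix.inv_eq_right_inv
    rw [hM, Matrix.mul_add, Matrix.mul_one, Matrix.add_mul, Matrix.one_mul,
      Matrix.vecMulVec_mul_vecMulVec, hae]
    ext i j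
    simp only [Matrix.add_apply, Matrix.vecMulVec_apply, Matrix.one_apply, ha, hd, Pi.add_apply,
      Pi.sub_apply, Pi.smul_apply, smul_eq_mul]
    field_simp
    ring
  have hMu : IsUnit M := (Matrix.isUnit_iff_isUnit_det M).2 (by rw [hMdet]; exact hr0.ne'.isUnit)
  have hMt : Mᵀ = 1 + Matrix.vecMulVec a e := by
    rw [hM, Matrix.transpose_add, Matrix.transpose_one, Matrix.transpose_vecMulVec]
  have hMit : M⁻¹ᵀ = 1 + Matrix.vecMulVec d e := by
    rw [hMinv, Matrix.transpose_add, Matrix.transpose_one, Matrix.transpose_vecMulVec]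
  have hSa : S *ᵥ a = S *ᵥ β + (r - 1) • e := by
    rw [ha, Matrix.mulVec_add, Matrix.mulVec_smul, hv]
  have haS : a ᵥ* S = S *ᵥ a := by rw [← Matrix.mulVec_transpose, hs]
  have hβe : (S *ᵥ β) ⬝ᵥ e = 0 := by
    rw [dotProduct_comm, Matrix.dotProduct_mulVec, hv']
    simp [he, hβ]
  have hβv : (S *ᵥ β) v = 0 := by simpa [he] using hβe
  have haSa : a ⬝ᵥ (S *ᵥ a) = β ⬝ᵥ S *ᵥ β + (r - 1) * (r - 1) := by
    rw [hSa, dotProduct_add, dotProduct_smul, hae, ha, add_dotProduct, smul_dotProduct,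
      dotProduct_comm e, hβe]
    simp
  have hS' : M * S * Mᵀ = S + Matrix.vecMulVec e (S *ᵥ a) + Matrix.vecMulVec (S *ᵥ a) e +
      (a ⬝ᵥ (S *ᵥ a)) • Matrix.vecMulVec e e := by
    rw [hMt, hM, Matrix.add_mul, Matrix.one_mul, Matrix.vecMulVec_mul, haS, Matrix.mul_add,
      Matrix.mul_one, Matrix.add_mul, Matrix.mul_vecMulVec, Matrix.vecMulVec_mul_vecMulVec,
      dotProduct_comm (S *ᵥ a) a]
    ext i j
    simp only [Matrix.add_apply, Matrix.vecMulVec_apply, Matrix.smul_apply, Pi.smul_apply,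
      smul_eq_mul]
    ring
  have hent : ∀ i j, (M * S * Mᵀ) i j = S i j + e i * (S *ᵥ a) j + (S *ᵥ a) i * e j +
      (a ⬝ᵥ (S *ᵥ a)) * (e i * e j) := by
    intro i j
    rw [hS']
    simp [Matrix.vecMulVec_apply]
  have hev : e v = 1 := by simp [he]
  have hei : ∀ i, i ≠ v → e i = 0 := fun i hi => by simp [he, hi]
  have hSv : ∀ j, S v j = e j := by
    intro j
    rw [← hv']
    simp [he]
  refine ⟨M * S * Mᵀ, ?_, ?_, ?_, ?_, ?_, ?_⟩
  · have := hS.mul_mul_conjTranspose_same (B := M) (Matrix.vecMul_injective_of_isUnit hMu)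
    rwa [Matrix.conjTranspose_eq_transpose_of_trivial] at this
  · intro i j hi hj
    rw [hent, hei i hi, hei j hj]
    ring
  · intro j hj
    rw [hent, hev, hei j hj, hSv, hei j hj, hSa]
    simp [hei j hj]
  · rw [hent, hev, hSv, hev, haSa, hSa]
    simp only [Pi.add_apply, Pi.smul_apply, hβv, hev, smul_eq_mul, ← hrc]
    ring
  · rw [Matrix.mul_inv_rev, Matrix.mul_inv_rev, ← Matrix.transpose_nonsing_inv, hMit, hMinv,
      Matrix.add_mul, Matrix.one_mul, Matrix.mul_add, Matrix.mul_one, Matrix.mul_vecMulVec, hKv,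
      Matrix.vecMulVec_mul, Matrix.vecMul_add, hKv', Matrix.vecMul_vecMulVec,
      hee]
    ext i j
    simp only [Matrix.add_apply, Matrix.sub_apply, Matrix.vecMulVec_apply, Matrix.smul_apply, hd,
      Pi.add_apply, Pi.sub_apply, Pi.smul_apply, smul_eq_mul, ← hrc]
    field_simp
    ring
  · rw [Matrix.det_mul, Matrix.det_mul, Matrix.det_transpose, hMdet, ← hrc]
    ring

/-- Extension of a vector by zero. -/
def extendZero {N : Finset V} (β : N → ℝ) (i : V) : ℝ := if h : i ∈ N then β ⟨i, h⟩ else 0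

lemma dotProduct_extendZero {N : Finset V} (β : N → ℝ) (g : V → ℝ) :
    g ⬝ᵥ extendZero β = (fun i : N => g i) ⬝ᵥ β := by
  rw [dotProduct, dotProduct, ← Finset.sum_subset (Finset.subset_univ N), ← Finset.sum_coe_sort]
  · simp [extendZero]
  · intro i _ hi
    simp [extendZero, hi]

lemma quad_single_sub_extendZero {D : Matrix V V ℝ} (hD : ∀ i j, D i j = D j i) {v : V}
    {N : Finset V} (β : N → ℝ) :
    (Pi.single v 1 - extendZero β) ⬝ᵥ D *ᵥ (Pi.single v 1 - extendZero β) =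
      D v v - 2 * (colBlock D v N ⬝ᵥ β) + β ⬝ᵥ block D N *ᵥ β := by
  have h1 : ∀ i, (D *ᵥ extendZero β) i = (fun j : N => D i j) ⬝ᵥ β :=
    fun i => dotProduct_extendZero β (D i)
  have h2 : extendZero β ⬝ᵥ D *ᵥ extendZero β = β ⬝ᵥ block D N *ᵥ β := by
    rw [dotProduct_comm, dotProduct_extendZero, dotProduct_comm]
    congr 1
    ext i
    rw [h1]
    rfl
  have h3 : (fun j : N => D v j) = colBlock D v N := by
    ext j; exact hD v j
  have h4 : extendZero β ⬝ᵥ D.col v = colBlock D v N ⬝ᵥ β := by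
    rw [dotProduct_comm, dotProduct_extendZero]
    rfl
  rw [Matrix.mulVec_sub, sub_dotProduct, dotProduct_sub, dotProduct_sub, h2,
    Matrix.mulVec_single_one, h4, single_one_dotProduct, single_one_dotProduct, h1, h3]
  simp only [Matrix.col_apply]
  ring

lemma trace_block_insert {M D : Matrix V V ℝ} {v : V} {N : Finset V} (h : v ∉ N)
    (hs : ∀ i j, M i j = M j i) (hD : ∀ i j, D i j = D j i)
    (hN : (block M N).PosDef) (hv : 0 < condVar M v N) :
    (block D (insert v N) * (block M (insert v N))⁻¹).trace =
      (block D N * (block M N)⁻¹).trace +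
      (Pi.single v 1 - extendZero ((block M N)⁻¹ *ᵥ colBlock M v N)) ⬝ᵥ
        D *ᵥ (Pi.single v 1 - extendZero ((block M N)⁻¹ *ᵥ colBlock M v N)) / condVar M v N := by
  rw [quad_single_sub_extendZero hD, condVar, ← trace_border_mul_inv hN _ _ hv,
    block_insert h (fun i _ => hs v i), block_insert h (fun i _ => hD v i),
    Matrix.inv_submatrix_equiv, Matrix.submatrix_mul_equiv]
  simp only [Matrix.trace, Matrix.diag_apply, Matrix.submatrix_apply]
  exact (insertEquiv h).sum_comp fun i => (border (block D N) (colBlock D v N) (D v v) *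
    (border (block M N) (colBlock M v N) (M v v))⁻¹) i i

/-- A partial matrix with positive Schur complements along an elimination sequence has a positive
definite completion whose inverse vanishes at the unspecified positions. Its determinant is the
ratio of the determinants of the specified blocks, and its inverse is the alternating sum of their
inverses, padded by zeros; the latter is stated through traces against symmetric matrices `D`. The
nodes not in the sequence carry an identity matrix, uncorrelated with the rest, so that the
induction stays within the matrices indexed by `V`. -/
lemma IsElim.exists_completion {l : List (V × Finset V)} (hl : IsElim l) {y : Sym2 V → ℝ}
    (hy : ∀ p ∈ l, 0 < condVar (symMat y) p.1 p.2) :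
    ∃ S : Matrix V V ℝ, S.PosDef ∧ (∀ i j, s(i, j) ∈ pairs l → S i j = y s(i, j)) ∧
      (∀ u, u ∉ verts l → S *ᵥ Pi.single u 1 = Pi.single u 1) ∧
      (∀ i j, i ≠ j → s(i, j) ∉ pairs l → S⁻¹ i j = 0) ∧
      S.det = elimRatio (fun A => (block (symMat y) A).det) l ∧
      ∀ D : Matrix V V ℝ, (∀ i j, D i j = D j i) →
        (D * S⁻¹).trace = ∑ u ∈ (verts l)ᶜ, D u u +
          (l.map fun p => (block D (fam p) * (block (symMat y) (fam p))⁻¹).trace -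
            (block D p.2 * (block (symMat y) p.2)⁻¹).trace).sum := by
  induction hl with
  | nil =>
    refine ⟨1, .one, by simp [pairs], fun u _ => Matrix.one_mulVec _, ?_, by simp [elimRatio], ?_⟩
    · intro i j hij _
      simp [hij]
    · intro D _
      simp [verts, Matrix.trace]
  | cons v N l hl hv hN ih =>
    have hy' : ∀ p ∈ l, 0 < condVar (symMat y) p.1 p.2 :=
      fun p hp => hy p (List.mem_cons_of_mem _ hp)
    have hc : 0 < condVar (symMat y) v N := hy _ List.mem_cons_self
    have hNy := hN.block_posDef (hl.posDef_of_condVar_pos (symMat_comm y) hy')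
    have hNv := hN.subset_verts hl
    have hvN : v ∉ N := fun h => hv (hNv h)
    obtain ⟨S, hS, hSy, hSu, hS0, hSd, hSt⟩ := ih hy'
    set β0 := (block (symMat y) N)⁻¹ *ᵥ colBlock (symMat y) v N with hβ0
    have hβv : extendZero β0 v = 0 := by simp [extendZero, hvN]
    obtain ⟨S', hS', h1, h2, h3, h4, h5⟩ := exists_posDef_replace hS (hSu v hv) hβv hc
    have hsymm : ∀ i j, S i j = S j i := fun i j => by simpa using hS.1.apply j i
    have hsymm' : ∀ i j, S' i j = S' j i := fun i j => by simpa using hS'.1.apply j i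
    have hNp : N.sym2 ⊆ pairs l := by
      rcases hN with hN | ⟨p, hp, h⟩
      · simp [show N = ∅ from hN]
      · exact (Finset.sym2_mono h).trans (hl.sym2_fam_subset p hp)
    have hSβ : ∀ j, (S *ᵥ extendZero β0) j = (fun i : N => S j i) ⬝ᵥ β0 :=
      fun j => dotProduct_extendZero β0 (S j)
    have hSβN : ∀ j : N, (S *ᵥ extendZero β0) j = colBlock (symMat y) v N j := by
      intro j
      have e1 : (fun i : N => S j i) = block (symMat y) N j := by
        ext i
        exact hSy _ _ (hNp (Finset.mk_mem_sym2_iff.2 ⟨j.2, i.2⟩))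
      rw [hSβ, e1]
      change (block (symMat y) N *ᵥ β0) j = _
      rw [hβ0, Matrix.mulVec_mulVec, Matrix.mul_nonsing_inv _
        ((Matrix.isUnit_iff_isUnit_det _).1 hNy.isUnit), Matrix.one_mulVec]
    have hvv : S' v v = symMat y v v := by
      rw [h3, dotProduct_comm, dotProduct_extendZero, condVar]
      simp_rw [hSβN]
      ring
    have hvj : ∀ j ∈ N, S' v j = y s(v, j) := by
      intro j hj
      rw [h2 j (fun h : j = v => hvN (h ▸ hj)), hSβN ⟨j, hj⟩, colBlock, symMat_comm]
      rfl
    have hvp : ∀ a b, s(a, b) ∈ pairs l → a ≠ v ∧ b ≠ v := by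
      intro a b h
      have := Finset.mk_mem_sym2_iff.1 (hl.pairs_subset h)
      exact ⟨fun h => hv (h ▸ this.1), fun h => hv (h ▸ this.2)⟩
    refine ⟨S', hS', ?_, ?_, ?_, ?_, ?_⟩
    · intro i j hij
      rw [pairs, Finset.mem_union] at hij
      rcases hij with hij | hij
      · obtain ⟨w, hw, hw'⟩ := Finset.mem_image.1 hij
        have hvw : S' v w = y s(v, w) := by
          rcases Finset.mem_insert.1 hw with rfl | hw
          · exact hvv
          · exact hvj w hw
        rcases Sym2.eq_iff.1 hw' with ⟨rfl, rfl⟩ | ⟨rfl, rfl⟩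
        · exact hvw
        · rw [hsymm', hvw, Sym2.eq_swap]
      · rw [h1 i j (hvp i j hij).1 (hvp i j hij).2, hSy i j hij]
    · intro u hu
      rw [verts_cons, Finset.mem_insert, not_or] at hu
      have hSu' : ∀ j, S j u = (Pi.single u 1 : V → ℝ) j := by
        intro j
        rw [← hSu u hu.2]
        simp
      ext j
      rw [Matrix.mulVec_single_one, Matrix.col_apply]
      by_cases hj : j = v
      · subst hj
        have : (fun i : N => S u i) = 0 := by
          ext i
          rw [hsymm, hSu', Pi.single_eq_of_ne (fun h : (i : V) = u => hu.2 (h ▸ hNv i.2))]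
          rfl
        rw [h2 u hu.1, hSβ, this, zero_dotProduct, Pi.single_eq_of_ne (Ne.symm hu.1)]
      · rw [h1 j u hj hu.1, hSu']
    · intro i j hij hp
      rw [pairs, Finset.mem_union, not_or] at hp
      have hb : ∀ i, i ∉ insert v N → (Pi.single v 1 - extendZero β0 : V → ℝ) i = 0 := by
        intro i hi
        rw [Finset.mem_insert, not_or] at hi
        simp [extendZero, hi.1, hi.2]
      have hb2 : (Pi.single v 1 - extendZero β0 : V → ℝ) i *
          (Pi.single v 1 - extendZero β0 : V → ℝ) j = 0 := by
        by_contra hne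
        have hi : i ∈ insert v N := by
          by_contra h; exact hne (by rw [hb i h, zero_mul])
        have hj : j ∈ insert v N := by
          by_contra h; exact hne (by rw [hb j h, mul_zero])
        rcases Finset.mem_insert.1 hi with rfl | hi'
        · exact hp.1 (Finset.mem_image_of_mem (fun w => s(i, w)) hj)
        · rcases Finset.mem_insert.1 hj with rfl | hj'
          · rw [Sym2.eq_swap] at hp
            exact hp.1 (Finset.mem_image_of_mem (fun w => s(j, w)) hi)
          · exact hp.2 (hNp (Finset.mk_mem_sym2_iff.2 ⟨hi', hj'⟩))
      have he2 : (Pi.single v 1 : V → ℝ) i * (Pi.single v 1 : V → ℝ) j = 0 := by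
        by_cases hi : i = v
        · subst hi
          rw [Pi.single_eq_of_ne (Ne.symm hij), mul_zero]
        · rw [Pi.single_eq_of_ne hi, zero_mul]
      rw [h4, Matrix.add_apply, Matrix.sub_apply, hS0 i j hij hp.2, Matrix.smul_apply,
        Matrix.vecMulVec_apply, Matrix.vecMulVec_apply, hb2, he2]
      simp
    · have hd := det_block_insert hvN (fun i _ => symMat_comm y v i) hNy
      have := hNy.det_pos
      rw [h5, hSd, elimRatio_cons, fam, hd]
      field_simp
    · intro D hD
      have hq : ∀ b : V → ℝ, (D * Matrix.vecMulVec b b).trace = b ⬝ᵥ D *ᵥ b := by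
        intro b
        rw [Matrix.mul_vecMulVec, Matrix.trace_vecMulVec, dotProduct_comm]
      have hcompl : ∑ u ∈ (verts l)ᶜ, D u u = D v v + ∑ u ∈ (insert v (verts l))ᶜ, D u u := by
        rw [Finset.compl_insert, Finset.add_sum_erase _ (fun u => D u u) (Finset.mem_compl.2 hv)]
      rw [h4, Matrix.mul_add, Matrix.mul_sub, Matrix.trace_add, Matrix.trace_sub, Matrix.mul_smul,
        Matrix.trace_smul, hq, hq, hSt D hD, List.map_cons, List.sum_cons, verts_cons, fam,
        trace_block_insert hvN (symMat_comm y) hD hNy hc, hcompl]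
      simp only [single_one_dotProduct, Matrix.mulVec_single_one, Matrix.col_apply, smul_eq_mul]
      rw [← hβ0]
      ring

end Completion

/-! ### Clique/separator ratios -/

section Ratios

variable {V : Type*} [Fintype V] [DecidableEq V] {G : SimpleGraph V}

omit [Fintype V] in
lemma sep_subset (e : Sym2 (Cliques G)) : ∃ Q : Cliques G, sep e ⊆ Q.1 := by
  induction e with | _ P Q
  exact ⟨P, Finset.inter_subset_left⟩

lemma cliqueSepRatio_congr (T : SimpleGraph (Cliques G)) {F F' : Finset V → ℝ}
    (h : ∀ Q : Cliques G, ∀ A, A ⊆ Q.1 → F A = F' A) :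
    cliqueSepRatio T F = cliqueSepRatio T F' := by
  rw [cliqueSepRatio, cliqueSepRatio]
  congr 1
  · exact Finset.prod_congr rfl fun Q _ => h Q _ subset_rfl
  · exact Finset.prod_congr rfl fun e _ => (sep_subset e).elim fun Q hQ => h Q _ hQ

lemma cliqueSepRatio_mul (T : SimpleGraph (Cliques G)) (F F' : Finset V → ℝ) :
    (cliqueSepRatio T fun A => F A * F' A) = cliqueSepRatio T F * cliqueSepRatio T F' := by
  simp only [cliqueSepRatio, Finset.prod_mul_distrib, mul_div_mul_comm]

lemma cliqueSepRatio_div (T : SimpleGraph (Cliques G)) (F F' : Finset V → ℝ) :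
    (cliqueSepRatio T fun A => F A / F' A) = cliqueSepRatio T F / cliqueSepRatio T F' := by
  simp only [cliqueSepRatio, Finset.prod_div_distrib]
  rw [div_div_div_comm]

lemma cliqueSepRatio_pos (T : SimpleGraph (Cliques G)) {F : Finset V → ℝ}
    (h : ∀ Q : Cliques G, ∀ A, A ⊆ Q.1 → 0 < F A) : 0 < cliqueSepRatio T F :=
  div_pos (Finset.prod_pos fun Q _ => h Q _ subset_rfl)
    (Finset.prod_pos fun e _ => (sep_subset e).elim fun Q hQ => h Q _ hQ)

omit [Fintype V] in
lemma IsElim.elimRatio_rpow_card {l : List (V × Finset V)} (hl : IsElim l) {c : ℝ} (hc : 0 < c) :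
    elimRatio (fun A => c ^ ((A.card : ℝ) / 2)) l = c ^ (((verts l).card : ℝ) / 2) := by
  induction hl with
  | nil => simp [elimRatio, verts]
  | cons v N l hl hv hN ih =>
    rw [elimRatio_cons, ih, verts_cons, fam, Finset.card_insert_of_notMem hv,
      Finset.card_insert_of_notMem fun h => hv (hN.subset_verts hl h), ← Real.rpow_sub hc,
      ← Real.rpow_add hc]
    push_cast
    ring_nf

omit [Fintype V] in
lemma elimRatio_rpow_mul_exp {d : Finset V → ℝ} (hd : ∀ A, 0 < d A) (t : Finset V → ℝ) (r c : ℝ)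
    (l : List (V × Finset V)) :
    elimRatio (fun A => d A ^ r * Real.exp (c * t A)) l =
      elimRatio d l ^ r * Real.exp (c * (l.map fun p => t (fam p) - t p.2).sum) := by
  induction l with
  | nil => simp [elimRatio]
  | cons p l ih =>
    have h0 : 0 < elimRatio d l := List.prod_pos fun x hx => by
      obtain ⟨q, -, rfl⟩ := List.mem_map.1 hx
      exact div_pos (hd _) (hd _)
    rw [elimRatio_cons, elimRatio_cons, ih, List.map_cons, List.sum_cons,
      Real.mul_rpow (div_pos (hd _) (hd _)).le h0.le, Real.div_rpow (hd _).le (hd _).le,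
      mul_div_mul_comm, ← Real.exp_sub, mul_add, Real.exp_add, mul_sub]
    ring

end Ratios

/-! ### Matrices in `M_G` -/

section Covariance

variable {V : Type*} [Fintype V] [DecidableEq V] {G : SimpleGraph V}

lemma CovSpace.symm (Sig : CovSpace G) (i j : V) : Sig.1 i j = Sig.1 j i := by
  simpa using Sig.2.1.isHermitian.apply j i

/-- All the entries of a matrix in `M_G`, indexed by the unordered pairs of nodes. -/
def covEntries (Sig : CovSpace G) (e : Sym2 V) : ℝ :=
  Sym2.lift ⟨fun i j => Sig.1 i j, fun i j => Sig.symm i j⟩ e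

lemma symMat_covEntries (Sig : CovSpace G) : symMat (covEntries Sig) = Sig.1 := rfl

lemma block_covSpace_posDef (Sig : CovSpace G) (A : Finset V) : (block Sig.1 A).PosDef :=
  Sig.2.1.submatrix Subtype.val_injective

lemma condVar_covSpace_pos (Sig : CovSpace G) {l : List (V × Finset V)} (hl : IsElim l) :
    ∀ p ∈ l, 0 < condVar Sig.1 p.1 p.2 := by
  induction hl with
  | nil => simp
  | cons v N l hl hv hN ih =>
    intro p hp
    rcases List.mem_cons.1 hp with rfl | hp
    · exact condVar_pos (fun h => hv (hN.subset_verts hl h)) (block_covSpace_posDef Sig _)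
    · exact ih p hp

/-- A partial matrix with positive Schur complements is the coordinate vector of a matrix in `M_G`,
whose determinant and inverse are given by the specified blocks. -/
lemma IsElim.exists_covSpace {l : List (V × Finset V)} (hl : IsElim l)
    (hv : verts l = Finset.univ) (hp : ∀ e, e ∈ pairs l ↔ (e.IsDiag ∨ e ∈ G.edgeSet))
    {y : Sym2 V → ℝ} (hy : ∀ p ∈ l, 0 < condVar (symMat y) p.1 p.2) :
    ∃ S : CovSpace G, (∀ e : FreeIdx G, freeCoord G S e = y e.1) ∧
      S.1.det = elimRatio (fun A => (block (symMat y) A).det) l ∧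
      ∀ D : Matrix V V ℝ, (∀ i j, D i j = D j i) →
        (D * S.1⁻¹).trace =
          (l.map fun p => (block D (fam p) * (block (symMat y) (fam p))⁻¹).trace -
            (block D p.2 * (block (symMat y) p.2)⁻¹).trace).sum := by
  obtain ⟨S, hS, h1, -, h2, h3, h4⟩ := hl.exists_completion hy
  refine ⟨⟨S, hS, fun i j hij hadj => h2 i j hij fun h => ?_⟩, ?_, h3, fun D hD => ?_⟩
  · rcases (hp _).1 h with h | h
    · exact hij h
    · exact hadj h
  · rintro ⟨e, he⟩
    induction e with | _ i j
    exact h1 i j ((hp _).2 he)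
  · simp [h4 D hD, hv]

/-- For `Sig` in `M_G`, the determinant is the ratio of the determinants of the blocks, and the
inverse is the alternating sum of the inverses of the blocks. -/
lemma IsElim.det_trace_covSpace {l : List (V × Finset V)} (hl : IsElim l)
    (hv : verts l = Finset.univ) (hp : ∀ e, e ∈ pairs l ↔ (e.IsDiag ∨ e ∈ G.edgeSet))
    (Sig : CovSpace G) :
    Sig.1.det = elimRatio (fun A => (block Sig.1 A).det) l ∧
      ∀ D : Matrix V V ℝ, (∀ i j, D i j = D j i) →
        (D * Sig.1⁻¹).trace = (l.map fun p => (block D (fam p) * (block Sig.1 (fam p))⁻¹).trace -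
            (block D p.2 * (block Sig.1 p.2)⁻¹).trace).sum := by
  obtain ⟨S, h1, h2⟩ := hl.exists_covSpace hv hp (y := covEntries Sig) (condVar_covSpace_pos Sig hl)
  have : S = Sig := freeCoord_injective G (funext fun e => h1 e)
  rw [this] at h2
  exact h2

end Covariance

/-! ### Conjugacy -/

section Conjugacy

variable {V : Type*} [Fintype V] [DecidableEq V] {n : ℕ}

/-- The increment `Φ* - Φ` of the scale matrix. -/
def scaleIncr (μ : V → ℝ) (ν : ℝ) (x : Fin n → V → ℝ) : Matrix V V ℝ :=
  scatter x + (ν * n / nuStar n ν) • Matrix.vecMulVec (μ - sampleMean x) (μ - sampleMean x)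

lemma nuStar_pos {ν : ℝ} (hν : 0 < ν) : 0 < nuStar n ν := by
  rw [nuStar]; positivity

omit [DecidableEq V] in
lemma scaleIncr_posSemidef (μ : V → ℝ) {ν : ℝ} (hν : 0 < ν) (x : Fin n → V → ℝ) :
    (scaleIncr μ ν x).PosSemidef := by
  have h (a : V → ℝ) : (Matrix.vecMulVec a a).PosSemidef := by
    simpa using Matrix.posSemidef_vecMulVec_self_star a
  have := nuStar_pos (n := n) hν
  exact (Matrix.posSemidef_sum _ fun i _ => h _).add ((h _).smul (by positivity))

omit [DecidableEq V] in
lemma block_phiStar_posDef {μ : V → ℝ} {ν : ℝ} (hν : 0 < ν) {Φ : Matrix V V ℝ}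
    (x : Fin n → V → ℝ) {A : Finset V} (hA : (block Φ A).PosDef) :
    (block (phiStar μ ν Φ x) A).PosDef := by
  have : block (phiStar μ ν Φ x) A = block Φ A + block (scaleIncr μ ν x) A := by
    rw [phiStar, add_assoc]; rfl
  rw [this]
  exact hA.add_posSemidef ((scaleIncr_posSemidef μ hν x).submatrix _)

omit [Fintype V] [DecidableEq V] in
/-- Completing the square in the mean: an identity of matrices of second moments. -/
lemma sum_sq_add_prior (μ m : V → ℝ) {ν : ℝ} (hν : 0 < ν) (x : Fin n → V → ℝ) :
    ∑ i, Matrix.vecMulVec (x i - m) (x i - m) + ν • Matrix.vecMulVec (m - μ) (m - μ) =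
      scaleIncr μ ν x +
        nuStar n ν • Matrix.vecMulVec (m - muStar μ ν x) (m - muStar μ ν x) := by
  have hs : nuStar n ν ≠ 0 := (nuStar_pos hν).ne'
  -- for `n = 0` both sides vanish, whatever the value of the empty mean
  have hmean : ∀ a, ∑ i, x i a = n * sampleMean x a := by
    intro a
    rcases Nat.eq_zero_or_pos n with rfl | hn
    · simp
    · have : (n : ℝ) ≠ 0 := by positivity
      simp [sampleMean, Finset.sum_apply]
      field_simp
  ext a b
  simp only [scaleIncr, scatter, muStar, Matrix.add_apply, Matrix.sum_apply, Matrix.smul_apply,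
    Matrix.vecMulVec_apply, Pi.sub_apply, Pi.smul_apply, Pi.add_apply, smul_eq_mul]
  have e : ∀ c : V → ℝ, ∑ i, (x i a - c a) * (x i b - c b) =
      ∑ i, x i a * x i b - n * sampleMean x a * c b - c a * (n * sampleMean x b) +
        n * (c a * c b) := by
    intro c
    rw [← hmean, ← hmean, Finset.sum_mul, Finset.mul_sum, ← Finset.sum_sub_distrib,
      ← Finset.sum_sub_distrib, show (n : ℝ) * (c a * c b) = ∑ _i : Fin n, c a * c b by simp,
      ← Finset.sum_add_distrib]
    exact Finset.sum_congr rfl fun i _ => by ring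
  rw [e m, e (sampleMean x)]
  have hn : (n : ℝ) = nuStar n ν - ν := by rw [nuStar]; ring
  rw [hn]
  field_simp
  ring

/-- Conjugacy of the normal part: what remains of the likelihood is a factor in `Sig` alone. -/
lemma likelihood_mul_normalPDF (μ m : V → ℝ) {ν : ℝ} (hν : 0 < ν) (x : Fin n → V → ℝ)
    {Sig : Matrix V V ℝ} (hS : Sig.PosDef) :
    likelihood x m Sig * normalPDF μ ((1 / ν) • Sig) m =
      (2 * Real.pi) ^ (-((n : ℝ) * (Fintype.card V : ℝ)) / 2) *
      (ν / nuStar n ν) ^ ((Fintype.card V : ℝ) / 2) *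
      (Sig.det ^ (-(n : ℝ) / 2) *
        Real.exp (-(1 / 2) * (scaleIncr μ ν x * Sig⁻¹).trace)) *
      normalPDF (muStar μ ν x) ((1 / nuStar n ν) • Sig) m := by
  have hs := nuStar_pos (n := n) hν
  have hd := hS.det_pos
  have hu : IsUnit Sig.det := hd.ne'.isUnit
  have hinv : ∀ c : ℝ, 0 < c → ((1 / c) • Sig)⁻¹ = c • Sig⁻¹ := by
    intro c hc
    apply Matrix.inv_eq_right_inv
    rw [Matrix.smul_mul, Matrix.mul_smul, smul_smul, Matrix.mul_nonsing_inv _ hu]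
    rw [one_div, inv_mul_cancel₀ hc.ne', one_smul]
  have hdet : ∀ c : ℝ, 0 < c → ((1 / c) • Sig).det ^ (-(1 : ℝ) / 2) =
      c ^ ((Fintype.card V : ℝ) / 2) * Sig.det ^ (-(1 : ℝ) / 2) := by
    intro c hc
    rw [Matrix.det_smul, Real.mul_rpow (by positivity) hd.le, ← Real.rpow_natCast,
      ← Real.rpow_mul (by positivity), one_div, Real.inv_rpow hc.le, ← Real.rpow_neg hc.le]
    ring_nf
  have htr : ∀ a : V → ℝ, a ⬝ᵥ Sig⁻¹ *ᵥ a = (Matrix.vecMulVec a a * Sig⁻¹).trace := by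
    intro a
    rw [Matrix.trace_mul_comm, Matrix.mul_vecMulVec, Matrix.trace_vecMulVec, dotProduct_comm]
  have hsq := congrArg (fun M => (M * Sig⁻¹).trace) (sum_sq_add_prior μ m hν x)
  simp only [Matrix.add_mul, Matrix.trace_add, Matrix.smul_mul, Matrix.trace_smul, Finset.sum_mul,
    Matrix.trace_sum, ← htr, smul_eq_mul] at hsq
  rw [likelihood]
  simp only [normalPDF]
  rw [Finset.prod_mul_distrib, Finset.prod_const, ← Real.exp_sum, ← Finset.mul_sum,
    Finset.card_univ, Fintype.card_fin, hinv ν hν, hinv _ hs, hdet ν hν, hdet _ hs,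
    Matrix.smul_mulVec, Matrix.smul_mulVec, dotProduct_smul, dotProduct_smul, smul_eq_mul,
    smul_eq_mul, Real.div_rpow hν.le hs.le]
  have e1 : ((2 * Real.pi) ^ (-(Fintype.card V : ℝ) / 2) * Sig.det ^ (-(1 : ℝ) / 2)) ^ n =
      (2 * Real.pi) ^ (-((n : ℝ) * (Fintype.card V : ℝ)) / 2) * Sig.det ^ (-(n : ℝ) / 2) := by
    rw [mul_pow, ← Real.rpow_natCast, ← Real.rpow_natCast, ← Real.rpow_mul (by positivity),
      ← Real.rpow_mul hd.le]
    ring_nf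
  have e2 : Real.exp (-(1 / 2) * ∑ i, (x i - m) ⬝ᵥ Sig⁻¹ *ᵥ (x i - m)) *
      Real.exp (-(1 / 2) * (ν * ((m - μ) ⬝ᵥ Sig⁻¹ *ᵥ (m - μ)))) =
      Real.exp (-(1 / 2) * (scaleIncr μ ν x * Sig⁻¹).trace) *
      Real.exp (-(1 / 2) * (nuStar n ν *
        ((m - muStar μ ν x) ⬝ᵥ Sig⁻¹ *ᵥ (m - muStar μ ν x)))) := by
    rw [← Real.exp_add, ← Real.exp_add, ← mul_add, ← mul_add, hsq]
  have hns : 0 < nuStar n ν ^ ((Fintype.card V : ℝ) / 2) := by positivity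
  have hns' := div_mul_cancel₀ (ν ^ ((Fintype.card V : ℝ) / 2)) hns.ne'
  rw [e1]
  linear_combination ((2 * Real.pi) ^ (-((n : ℝ) * (Fintype.card V : ℝ)) / 2) *
    Sig.det ^ (-(n : ℝ) / 2) * (2 * Real.pi) ^ (-(Fintype.card V : ℝ) / 2) *
    Sig.det ^ (-(1 : ℝ) / 2)) * (ν ^ ((Fintype.card V : ℝ) / 2) * e2 -
      Real.exp (-(1 / 2) * (scaleIncr μ ν x * Sig⁻¹).trace) *
      Real.exp (-(1 / 2) * (nuStar n ν *
        ((m - muStar μ ν x) ⬝ᵥ Sig⁻¹ *ᵥ (m - muStar μ ν x)))) * hns')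

/-- Conjugacy of one inverse Wishart factor. The powers of `ν` and `ν'` only compensate those in
the normal inverse Wishart constants. -/
lemma invWishartPDF_update {ι : Type*} [Fintype ι] [DecidableEq ι] {Φ D Sig : Matrix ι ι ℝ}
    (hΦ : Φ.PosDef) (hΦD : (Φ + D).PosDef) (hS : Sig.PosDef) {a ν ν' : ℝ}
    (ha : (Fintype.card ι : ℝ) - 1 < a) (hν : 0 < ν) (hν' : 0 < ν') (n : ℕ) :
    invWishartPDF Φ a Sig * (Sig.det ^ (-(n : ℝ) / 2) * Real.exp (-(1 / 2) * (D * Sig⁻¹).trace)) =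
      niwConst (a + n) (Φ + D) ν' / niwConst a Φ ν * (ν' / ν) ^ ((Fintype.card ι : ℝ) / 2) *
        invWishartPDF (Φ + D) (a + n) Sig := by
  have h1 := hΦ.det_pos
  have h2 := hΦD.det_pos
  have h3 := hS.det_pos
  have hn : (0 : ℝ) ≤ n := Nat.cast_nonneg n
  have g1 := multiGamma_pos (q := Fintype.card ι) (a := a / 2) (by linarith)
  have g2 := multiGamma_pos (q := Fintype.card ι) (a := (a + n) / 2) (by linarith)
  unfold invWishartPDF niwConst
  have e1 : Sig.det ^ (-(a + n + (Fintype.card ι : ℝ) + 1) / 2) =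
      Sig.det ^ (-(a + (Fintype.card ι : ℝ) + 1) / 2) * Sig.det ^ (-(n : ℝ) / 2) := by
    rw [← Real.rpow_add h3]; ring_nf
  have e2 : Real.exp (-(1 / 2) * ((Φ + D) * Sig⁻¹).trace) =
      Real.exp (-(1 / 2) * (Φ * Sig⁻¹).trace) * Real.exp (-(1 / 2) * (D * Sig⁻¹).trace) := by
    rw [← Real.exp_add, Matrix.add_mul, Matrix.trace_add, mul_add]
  rw [e1, e2, Real.div_rpow hν'.le hν.le]
  field_simp

variable {G : SimpleGraph V}

/-- Conjugacy of the hyper normal inverse Wishart law, with the constant made explicit. -/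
lemma likelihood_mul_hyperNIWPDF {T : SimpleGraph (Cliques G)} (hT : IsJunctionTree G T)
    (μ : V → ℝ) {ν : ℝ} (hν : 0 < ν) {Φ : Matrix V V ℝ}
    (hΦ : ∀ Q : Cliques G, (block Φ Q.1).PosDef) {ϑ : ℝ} (hϑ : (Fintype.card V : ℝ) - 1 < ϑ)
    (x : Fin n → V → ℝ) (m : V → ℝ) (Sig : CovSpace G) :
    likelihood x m Sig.1 * hyperNIWPDF T μ ν Φ ϑ m Sig.1 =
      (2 * Real.pi) ^ (-((n : ℝ) * (Fintype.card V : ℝ)) / 2) *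
        (kappa T (dofStar n ϑ) (phiStar μ ν Φ x) (nuStar n ν) / kappa T ϑ Φ ν) *
      hyperNIWPDF T (muStar μ ν x) (nuStar n ν) (phiStar μ ν Φ x) (dofStar n ϑ) m Sig.1 := by
  obtain ⟨l, hl, hv, hp, -, hratio⟩ := hT.exists_isElim
  obtain ⟨hdet, htr⟩ := hl.det_trace_covSpace hv hp Sig
  have hs := nuStar_pos (n := n) hν
  set D := scaleIncr μ ν x with hD
  have hΦD : phiStar μ ν Φ x = Φ + D := by rw [phiStar, add_assoc]; rfl
  have hDs : ∀ i j, D i j = D j i := fun i j => by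
    simpa using (scaleIncr_posSemidef μ hν x).1.apply j i
  have hg : (cliqueSepRatio T fun A => (block Sig.1 A).det ^ (-(n : ℝ) / 2) *
      Real.exp (-(1 / 2) * (block D A * (block Sig.1 A)⁻¹).trace)) =
      Sig.1.det ^ (-(n : ℝ) / 2) * Real.exp (-(1 / 2) * (D * Sig.1⁻¹).trace) := by
    have hpos : ∀ A, 0 < (block Sig.1 A).det := fun A => (block_covSpace_posDef Sig A).det_pos
    rw [hratio, elimRatio_rpow_mul_exp hpos (fun A => (block D A * (block Sig.1 A)⁻¹).trace),
      htr D hDs, ← hdet]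
    · intro Q A _
      have := hpos A
      positivity
    · simp [block, Matrix.trace]
  have hc : (cliqueSepRatio T fun A => (nuStar n ν / ν) ^ ((A.card : ℝ) / 2)) =
      (nuStar n ν / ν) ^ ((Fintype.card V : ℝ) / 2) := by
    rw [hratio, hl.elimRatio_rpow_card (by positivity), hv, Finset.card_univ]
    · intro Q A _
      positivity
    · simp
  have hup : hyperInvWishartPDF T Φ ϑ Sig.1 *
      (Sig.1.det ^ (-(n : ℝ) / 2) * Real.exp (-(1 / 2) * (D * Sig.1⁻¹).trace)) =
      kappa T (dofStar n ϑ) (phiStar μ ν Φ x) (nuStar n ν) / kappa T ϑ Φ ν *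
        (nuStar n ν / ν) ^ ((Fintype.card V : ℝ) / 2) *
        hyperInvWishartPDF T (phiStar μ ν Φ x) (dofStar n ϑ) Sig.1 := by
    rw [← hg, ← hc, hyperInvWishartPDF, hyperInvWishartPDF, kappa, kappa, ← cliqueSepRatio_mul,
      ← cliqueSepRatio_div, ← cliqueSepRatio_mul, ← cliqueSepRatio_mul]
    refine cliqueSepRatio_congr T fun Q A hA => ?_
    have hdof : margDof (dofStar n ϑ) A = margDof ϑ A + n := by
      rw [margDof, margDof, dofStar]; ring
    have hPA := block_posDef_mono hA (hΦ Q)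
    have hPDA := block_phiStar_posDef (μ := μ) hν x hPA
    have hbl : block (phiStar μ ν Φ x) A = block Φ A + block D A := by rw [hΦD]; rfl
    rw [hbl] at hPDA ⊢
    rw [hdof, invWishartPDF_update hPA hPDA (block_covSpace_posDef Sig A)
      (card_sub_one_lt_margDof hϑ A) hν hs n, Fintype.card_coe]
  rw [hyperNIWPDF, hyperNIWPDF, ← mul_assoc, likelihood_mul_normalPDF μ m hν x Sig.2.1, ← hD]
  have hcc : (ν / nuStar n ν) ^ ((Fintype.card V : ℝ) / 2) *
      (nuStar n ν / ν) ^ ((Fintype.card V : ℝ) / 2) = 1 := by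
    rw [← Real.mul_rpow (by positivity) (by positivity), div_mul_div_cancel₀ hs.ne',
      div_self hν.ne', Real.one_rpow]
  generalize hyperInvWishartPDF T Φ ϑ Sig.1 = I1 at *
  generalize hyperInvWishartPDF T (phiStar μ ν Φ x) (dofStar n ϑ) Sig.1 = I2 at *
  generalize kappa T (dofStar n ϑ) (phiStar μ ν Φ x) (nuStar n ν) / kappa T ϑ Φ ν = K at *
  generalize normalPDF (muStar μ ν x) ((1 / nuStar n ν) • Sig.1) m = Z at *
  generalize (2 * Real.pi) ^ (-((n : ℝ) * (Fintype.card V : ℝ)) / 2) = P at *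
  linear_combination P * (ν / nuStar n ν) ^ ((Fintype.card V : ℝ) / 2) * Z * hup +
    P * Z * K * I2 * hcc

end Conjugacy

/-! ### The measure on `M_G` and the normalization -/

section CovMeasure

lemma ofReal_list_prod {α : Type*} {l : List α} {g : α → ℝ} (h : ∀ a ∈ l, 0 ≤ g a) :
    ENNReal.ofReal (l.map g).prod = (l.map fun a => ENNReal.ofReal (g a)).prod := by
  induction l with
  | nil => simp
  | cons a l ih =>
    rw [List.map_cons, List.prod_cons, List.map_cons, List.prod_cons,
      ENNReal.ofReal_mul (h a List.mem_cons_self), ih fun b hb => h b (List.mem_cons_of_mem _ hb)]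

variable {V : Type*} [Fintype V] [DecidableEq V] (G : SimpleGraph V)

/-- `M_G` is Polish: `Sig ↦ (Sig, Sig⁻¹)` embeds it as a closed set of pairs of matrices. -/
instance polishSpace_covSpace : PolishSpace (CovSpace G) := by
  have : PolishSpace (Matrix V V ℝ) := inferInstanceAs (PolishSpace (V → V → ℝ))
  have hdet (S : CovSpace G) : S.1.det ≠ 0 := S.2.1.det_pos.ne'
  have hcont : Continuous fun S : CovSpace G => S.1⁻¹ := by
    simp only [Matrix.inv_def, Ring.inverse_eq_inv']
    exact ((continuous_subtype_val.matrix_det).inv₀ hdet).smul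
      continuous_subtype_val.matrix_adjugate
  have hemb : Topology.IsEmbedding fun S : CovSpace G => (S.1, S.1⁻¹) :=
    .of_comp (continuous_subtype_val.prodMk hcont) continuous_fst Topology.IsEmbedding.subtypeVal
  refine Topology.IsClosedEmbedding.polishSpace (f := fun S : CovSpace G => (S.1, S.1⁻¹))
    ⟨hemb, ?_⟩
  have hrange : Set.range (fun S : CovSpace G => (S.1, S.1⁻¹)) =
      {p : Matrix V V ℝ × Matrix V V ℝ | p.1ᵀ = p.1} ∩
      {p | ∀ x : V → ℝ, 0 ≤ x ⬝ᵥ p.1 *ᵥ x} ∩ {p | p.1 * p.2 = 1} ∩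
      {p | ∀ i j, i ≠ j → ¬ G.Adj i j → p.2 i j = 0} := by
    ext ⟨S, K⟩
    constructor
    · rintro ⟨S', h⟩
      obtain ⟨rfl, rfl⟩ := Prod.mk.inj h
      refine ⟨⟨⟨isHermitian_real_iff.1 S'.2.1.1, fun x => ?_⟩,
        Matrix.mul_nonsing_inv _ (hdet S').isUnit⟩, S'.2.2⟩
      simpa using S'.2.1.posSemidef.dotProduct_mulVec_nonneg x
    · rintro ⟨⟨⟨h1, h2⟩, h3⟩, h4⟩
      simp only [Set.mem_ofPred_eq] at h1 h2 h3 h4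
      have hK : S⁻¹ = K := Matrix.inv_eq_right_inv h3
      have hps : S.PosSemidef := .of_dotProduct_mulVec_nonneg (isHermitian_real_iff.2 h1)
        (by simpa using h2)
      have hd : S.det ≠ 0 := fun h => by
        have := congrArg Matrix.det h3
        simp [h] at this
      exact ⟨⟨S, hps.posDef_iff_det_ne_zero.2 hd, hK ▸ h4⟩, by simp [hK]⟩
  rw [hrange]
  refine (((isClosed_eq (by fun_prop) (by fun_prop)).inter ?_).inter
    (isClosed_eq (by fun_prop) (by fun_prop))).inter ?_
  · simp only [Set.ofPred_forall]
    exact isClosed_iInter fun x => isClosed_le continuous_const (by fun_prop)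
  · simp only [Set.ofPred_forall]
    exact isClosed_iInter fun i => isClosed_iInter fun j => isClosed_iInter fun _ =>
      isClosed_iInter fun _ => isClosed_eq (by fun_prop) continuous_const

lemma measurable_covSpace_entry (i j : V) : Measurable fun Sig : CovSpace G => Sig.1 i j :=
  (continuous_subtype_val.matrix_elem i j).measurable

/-- By the Lusin–Souslin theorem, as `M_G` is Polish. -/
lemma measurableEmbedding_freeCoord : MeasurableEmbedding (freeCoord G) := by
  refine Measurable.measurableEmbedding (measurable_pi_iff.2 ?_) (freeCoord_injective G)
  rintro ⟨e, he⟩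
  induction e with | _ i j
  exact measurable_covSpace_entry G i j

instance sigmaFinite_covMeasure : SigmaFinite (covMeasure G) := by
  classical
  have h := measurableEmbedding_freeCoord G
  refine SigmaFinite.of_map _ h.measurable.aemeasurable ?_
  rw [covMeasure, h.map_comap]
  infer_instance

variable {G}

/-- The integral over `M_G` of a function of the free coordinates that vanishes at the partial
matrices not coming from `M_G` is its integral over all values of the free coordinates. The base
point `0` is immaterial: `f` does not depend on the other coordinates. -/
lemma lintegral_covMeasure {s : Finset (Sym2 V)} (hs : ∀ e, e ∈ s ↔ (e.IsDiag ∨ e ∈ G.edgeSet))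
    {f : (Sym2 V → ℝ) → ENNReal}
    (hf : ∀ y y' : Sym2 V → ℝ, (∀ e ∈ s, y e = y' e) → f y = f y')
    (hsupp : ∀ y, f y ≠ 0 → ∃ S : CovSpace G, ∀ e : FreeIdx G, freeCoord G S e = y e.1) :
    ∫⁻ Sig, f (covEntries Sig) ∂(covMeasure G) = (∫⋯∫⁻_s, f) 0 := by
  classical
  have h := measurableEmbedding_freeCoord G
  let e : FreeIdx G ≃ s := Equiv.subtypeEquivRight fun x => (hs x).symm
  let F : (FreeIdx G → ℝ) → ENNReal := fun y =>
    f (Function.updateFinset 0 s (MeasurableEquiv.piCongrLeft (fun _ : s => ℝ) e y))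
  have hval : ∀ (y : FreeIdx G → ℝ) (x : Sym2 V) (hx : x ∈ s),
      Function.updateFinset (0 : Sym2 V → ℝ) s
        (MeasurableEquiv.piCongrLeft (fun _ : s => ℝ) e y) x = y ⟨x, (hs x).1 hx⟩ := by
    intro y x hx
    rw [Function.updateFinset, dif_pos hx]
    exact Equiv.piCongrLeft_apply_apply (fun _ => ℝ) e y ⟨x, (hs x).1 hx⟩
  have h1 : ∀ Sig : CovSpace G, f (covEntries Sig) = F (freeCoord G Sig) :=
    fun Sig => hf _ _ fun x hx => (hval (freeCoord G Sig) x hx).symm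
  simp_rw [h1]
  rw [← h.lintegral_map, covMeasure, h.map_comap, ← lintegral_indicator h.measurableSet_range]
  have h2 : (Set.range (freeCoord G)).indicator F = F := by
    refine Set.indicator_eq_self.2 fun y hy => ?_
    obtain ⟨S, hS⟩ := hsupp _ hy
    exact ⟨S, funext fun x => (hS x).trans (hval y x.1 ((hs _).2 x.2))⟩
  rw [h2, lmarginal, ← volume_pi,
    ← (volume_measurePreserving_piCongrLeft (fun _ : s => ℝ) e).lintegral_comp_emb
      (MeasurableEquiv.measurableEmbedding _)]

variable {T : SimpleGraph (Cliques G)}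

lemma hyperInvWishartPDF_pos (T : SimpleGraph (Cliques G)) {Φ : Matrix V V ℝ}
    (hΦ : ∀ Q : Cliques G, (block Φ Q.1).PosDef) {ϑ : ℝ} (hϑ : (Fintype.card V : ℝ) - 1 < ϑ)
    (Sig : CovSpace G) : 0 < hyperInvWishartPDF T Φ ϑ Sig.1 :=
  cliqueSepRatio_pos T fun Q A hA => invWishartPDF_pos (block_posDef_mono hA (hΦ Q))
    (block_covSpace_posDef Sig A) (card_sub_one_lt_margDof hϑ A)

/-- The hyper inverse Wishart density integrates to one. -/
lemma lintegral_hyperInvWishartPDF (hT : IsJunctionTree G T) {Φ : Matrix V V ℝ}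
    (hΦ : ∀ Q : Cliques G, (block Φ Q.1).PosDef) {ϑ : ℝ} (hϑ : (Fintype.card V : ℝ) - 1 < ϑ) :
    ∫⁻ Sig : CovSpace G, ENNReal.ofReal (hyperInvWishartPDF T Φ ϑ Sig.1) ∂(covMeasure G) = 1 := by
  obtain ⟨l, hl, hv, hp, hfam, hratio⟩ := hT.exists_isElim
  have hΦl : ∀ p ∈ l, (block Φ (fam p)).PosDef := fun p hp' => by
    obtain ⟨Q, hQ⟩ := hfam p hp'
    exact block_posDef_mono hQ (hΦ Q)
  have h1 : ∀ Sig : CovSpace G, ENNReal.ofReal (hyperInvWishartPDF T Φ ϑ Sig.1) =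
      elimDensity Φ ϑ l (covEntries Sig) := by
    intro Sig
    rw [hyperInvWishartPDF, hratio, elimRatio, elimDensity]
    · have hstep : ∀ p ∈ l, ENNReal.ofReal (invWishartPDF (block Φ (fam p)) (margDof ϑ (fam p))
          (block Sig.1 (fam p)) / invWishartPDF (block Φ p.2) (margDof ϑ p.2) (block Sig.1 p.2)) =
          stepDensity Φ ϑ p (covEntries Sig) := by
        intro p hp'
        rw [stepDensity, symMat_covEntries, if_pos (condVar_covSpace_pos Sig hl p hp')]
      have hnn : ∀ p ∈ l, 0 ≤ invWishartPDF (block Φ (fam p)) (margDof ϑ (fam p))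
          (block Sig.1 (fam p)) / invWishartPDF (block Φ p.2) (margDof ϑ p.2)
          (block Sig.1 p.2) := by
        intro p hp'
        have hN := block_posDef_mono (Finset.subset_insert _ _) (hΦl p hp')
        exact (div_pos (invWishartPDF_pos (hΦl p hp') (block_covSpace_posDef Sig _)
          (card_sub_one_lt_margDof hϑ _)) (invWishartPDF_pos hN (block_covSpace_posDef Sig _)
          (card_sub_one_lt_margDof hϑ _))).le
      rw [← List.map_congr_left hstep, ofReal_list_prod hnn]
    · intro Q A hA
      exact (invWishartPDF_pos (block_posDef_mono hA (hΦ Q)) (block_covSpace_posDef Sig A)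
        (card_sub_one_lt_margDof hϑ A)).ne'
    · simp [invWishartPDF, multiGamma, block, Matrix.trace]
  simp_rw [h1]
  rw [lintegral_covMeasure hp, hl.lmarginal_elimDensity hϑ hΦl]
  · rfl
  · intro y y' h
    rw [elimDensity, elimDensity]
    congr 1
    exact List.map_congr_left fun p hp' => stepDensity_congr Φ ϑ p fun e he =>
      h e (hl.sym2_fam_subset p hp' he)
  · intro y hy
    obtain ⟨S, hS, -⟩ := hl.exists_covSpace hv hp (condVar_pos_of_elimDensity_ne_zero hy)
    exact ⟨S, hS⟩

lemma normalPDF_pos {ι : Type*} [Fintype ι] [DecidableEq ι] {S : Matrix ι ι ℝ} (hS : S.PosDef)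
    (m x : ι → ℝ) : 0 < normalPDF m S x := by
  have := hS.det_pos
  unfold normalPDF
  positivity

lemma lintegral_normalPDF {ι : Type*} [Fintype ι] [DecidableEq ι] {S : Matrix ι ι ℝ}
    (hS : S.PosDef) (m : ι → ℝ) : ∫⁻ x, ENNReal.ofReal (normalPDF m S x) = 1 := by
  have hd := hS.det_pos
  simp only [normalPDF]
  have h0 : 0 ≤ (2 * Real.pi) ^ (-(Fintype.card ι : ℝ) / 2) * S.det ^ (-(1 : ℝ) / 2) := by
    positivity
  simp_rw [ENNReal.ofReal_mul h0]
  rw [lintegral_const_mul' _ _ ENNReal.ofReal_ne_top, lintegral_gaussian hS.inv,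
    ← ENNReal.ofReal_mul h0, ← ENNReal.ofReal_one, Matrix.det_nonsing_inv, Ring.inverse_eq_inv',
    Real.inv_rpow hd.le, neg_div, neg_div, Real.rpow_neg (by positivity), Real.rpow_neg hd.le]
  congr 1
  have : 0 < (2 * Real.pi) ^ ((Fintype.card ι : ℝ) / 2) := by positivity
  have : 0 < S.det ^ ((1 : ℝ) / 2) := by positivity
  field_simp

lemma measurable_hyperNIWPDF (T : SimpleGraph (Cliques G)) (μ : V → ℝ) (ν : ℝ) (Φ : Matrix V V ℝ)
    (ϑ : ℝ) : Measurable fun θ : (V → ℝ) × CovSpace G => hyperNIWPDF T μ ν Φ ϑ θ.1 θ.2.1 := by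
  have he : ∀ i j, Measurable fun θ : (V → ℝ) × CovSpace G => θ.2.1 i j :=
    fun i j => (measurable_covSpace_entry G i j).comp measurable_snd
  have he' : ∀ i j, Measurable fun θ : (V → ℝ) × CovSpace G => ((1 / ν) • θ.2.1) i j :=
    fun i j => (he i j).const_mul _
  have hd := measurable_matrix_det he'
  have hi := measurable_matrix_inv he'
  have hx : ∀ i, Measurable fun θ : (V → ℝ) × CovSpace G => (θ.1 - μ) i :=
    fun i => ((measurable_pi_apply i).comp measurable_fst).sub_const _
  have h1 : Measurable fun θ : (V → ℝ) × CovSpace G => normalPDF μ ((1 / ν) • θ.2.1) θ.1 := by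
    have hq : Measurable fun θ : (V → ℝ) × CovSpace G =>
        (θ.1 - μ) ⬝ᵥ (((1 / ν) • θ.2.1)⁻¹ *ᵥ (θ.1 - μ)) :=
      Finset.measurable_sum _ fun i _ => (hx i).mul
        (Finset.measurable_sum _ fun j _ => (hi i j).mul (hx j))
    exact ((hd.pow_const _).const_mul _).mul (hq.const_mul _).exp
  have h2 (A : Finset V) : Measurable fun θ : (V → ℝ) × CovSpace G =>
      invWishartPDF (block Φ A) (margDof ϑ A) (block θ.2.1 A) :=
    measurable_invWishartPDF _ _ (X := fun θ : (V → ℝ) × CovSpace G => block θ.2.1 A)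
      fun i j => he i.1 j.1
  exact h1.mul ((Finset.measurable_prod _ fun Q _ => h2 Q.1).div
    (Finset.measurable_prod _ fun e _ => h2 (sep e)))

lemma hyperNIWPDF_pos (T : SimpleGraph (Cliques G)) (μ : V → ℝ) {ν : ℝ} (hν : 0 < ν)
    {Φ : Matrix V V ℝ} (hΦ : ∀ Q : Cliques G, (block Φ Q.1).PosDef) {ϑ : ℝ}
    (hϑ : (Fintype.card V : ℝ) - 1 < ϑ) (m : V → ℝ) (Sig : CovSpace G) :
    0 < hyperNIWPDF T μ ν Φ ϑ m Sig.1 :=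
  mul_pos (normalPDF_pos (Sig.2.1.smul (by positivity)) _ _)
    (hyperInvWishartPDF_pos T hΦ hϑ Sig)

/-- The hyper normal inverse Wishart density is a probability density. -/
lemma integrable_integral_hyperNIWPDF (hT : IsJunctionTree G T) (μ : V → ℝ) {ν : ℝ} (hν : 0 < ν)
    {Φ : Matrix V V ℝ} (hΦ : ∀ Q : Cliques G, (block Φ Q.1).PosDef) {ϑ : ℝ}
    (hϑ : (Fintype.card V : ℝ) - 1 < ϑ) :
    Integrable (fun θ : (V → ℝ) × CovSpace G => hyperNIWPDF T μ ν Φ ϑ θ.1 θ.2.1)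
        (volume.prod (covMeasure G)) ∧
      ∫ Sig : CovSpace G, ∫ m : V → ℝ, hyperNIWPDF T μ ν Φ ϑ m Sig.1 ∂volume ∂(covMeasure G) =
        1 := by
  have hm := measurable_hyperNIWPDF T μ ν Φ ϑ
  have hnn : ∀ θ : (V → ℝ) × CovSpace G, 0 ≤ hyperNIWPDF T μ ν Φ ϑ θ.1 θ.2.1 :=
    fun θ => (hyperNIWPDF_pos T μ hν hΦ hϑ θ.1 θ.2).le
  have hl : ∫⁻ θ : (V → ℝ) × CovSpace G, ENNReal.ofReal (hyperNIWPDF T μ ν Φ ϑ θ.1 θ.2.1)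
      ∂(volume.prod (covMeasure G)) = 1 := by
    rw [lintegral_prod_symm _ hm.ennreal_ofReal.aemeasurable,
      ← lintegral_hyperInvWishartPDF hT hΦ hϑ]
    refine lintegral_congr fun Sig => ?_
    have hS : ((1 / ν) • Sig.1).PosDef := Sig.2.1.smul (by positivity)
    simp only [hyperNIWPDF]
    simp_rw [ENNReal.ofReal_mul (normalPDF_pos hS μ _).le]
    rw [lintegral_mul_const' _ _ ENNReal.ofReal_ne_top, lintegral_normalPDF hS, one_mul]
  have hint : Integrable (fun θ : (V → ℝ) × CovSpace G => hyperNIWPDF T μ ν Φ ϑ θ.1 θ.2.1)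
      (volume.prod (covMeasure G)) := by
    refine ⟨hm.aestronglyMeasurable, ?_⟩
    rw [hasFiniteIntegral_iff_ofReal (.of_forall hnn), hl]
    exact ENNReal.one_lt_top
  refine ⟨hint, ?_⟩
  rw [← integral_prod_symm _ hint, integral_eq_lintegral_of_nonneg_ae (.of_forall hnn)
    hm.aestronglyMeasurable, hl, ENNReal.toReal_one]

end CovMeasure

end HyperNIW

end

theorem mainTheorem3 {V : Type*} [Fintype V] [DecidableEq V]
    (G : SimpleGraph V) (hG : HyperNIW.IsDecomposable G)
    (T : SimpleGraph (HyperNIW.Cliques G)) (hT : HyperNIW.IsJunctionTree G T)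
    (μ : V → ℝ) (ν : ℝ) (hν : 0 < ν)
    (Φ : Matrix V V ℝ) (hΦ : ∀ Q : HyperNIW.Cliques G, (HyperNIW.block Φ Q.1).PosDef)
    (ϑ : ℝ) (hϑ : (Fintype.card V : ℝ) - 1 < ϑ)
    (n : ℕ) (x : Fin n → V → ℝ) :
    -- the prior is a probability density
    (Integrable (fun θ : (V → ℝ) × HyperNIW.CovSpace G =>
        HyperNIW.hyperNIWPDF T μ ν Φ ϑ θ.1 θ.2.1) (volume.prod (HyperNIW.covMeasure G)) ∧
      ∫ Sig : HyperNIW.CovSpace G, ∫ m : V → ℝ,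
        HyperNIW.hyperNIWPDF T μ ν Φ ϑ m Sig.1 ∂volume ∂(HyperNIW.covMeasure G) = 1) ∧
    -- the marginal likelihood
    Integrable (fun θ : (V → ℝ) × HyperNIW.CovSpace G =>
        HyperNIW.likelihood x θ.1 θ.2.1 * HyperNIW.hyperNIWPDF T μ ν Φ ϑ θ.1 θ.2.1)
      (volume.prod (HyperNIW.covMeasure G)) ∧
    HyperNIW.marginalLikelihood T μ ν Φ ϑ x =
      (2 * Real.pi) ^ (-((n : ℝ) * (Fintype.card V : ℝ)) / 2) *
        (HyperNIW.kappa T (HyperNIW.dofStar n ϑ) (HyperNIW.phiStar μ ν Φ x)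
            (HyperNIW.nuStar n ν) /
          HyperNIW.kappa T ϑ Φ ν) ∧
    -- the starred parameters are those of the posterior law
    ∀ (m : V → ℝ) (Sig : HyperNIW.CovSpace G),
      HyperNIW.likelihood x m Sig.1 * HyperNIW.hyperNIWPDF T μ ν Φ ϑ m Sig.1 =
        HyperNIW.marginalLikelihood T μ ν Φ ϑ x *
          HyperNIW.hyperNIWPDF T (HyperNIW.muStar μ ν x) (HyperNIW.nuStar n ν)
            (HyperNIW.phiStar μ ν Φ x) (HyperNIW.dofStar n ϑ) m Sig.1 := by
  have hs := HyperNIW.nuStar_pos (n := n) hν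
  have hϑs : (Fintype.card V : ℝ) - 1 < HyperNIW.dofStar n ϑ := by
    have : (0 : ℝ) ≤ n := Nat.cast_nonneg n
    rw [HyperNIW.dofStar]
    linarith
  have hpost := HyperNIW.integrable_integral_hyperNIWPDF hT (HyperNIW.muStar μ ν x) hs
    (fun Q => HyperNIW.block_phiStar_posDef (μ := μ) hν x (hΦ Q)) hϑs
  have hconj := HyperNIW.likelihood_mul_hyperNIWPDF hT μ hν hΦ hϑ x
  have hmarg : HyperNIW.marginalLikelihood T μ ν Φ ϑ x =
      (2 * Real.pi) ^ (-((n : ℝ) * (Fintype.card V : ℝ)) / 2) *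
        (HyperNIW.kappa T (HyperNIW.dofStar n ϑ) (HyperNIW.phiStar μ ν Φ x)
            (HyperNIW.nuStar n ν) /
          HyperNIW.kappa T ϑ Φ ν) := by
    rw [HyperNIW.marginalLikelihood]
    simp_rw [hconj, integral_const_mul]
    rw [hpost.2, mul_one]
  refine ⟨HyperNIW.integrable_integral_hyperNIWPDF hT μ hν hΦ hϑ, ?_, hmarg, fun m Sig => ?_⟩
  · simp_rw [hconj]
    exact hpost.1.const_mul _
  · rw [hmarg, hconj]
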